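/- Let $\kappa_1<\kappa_2$ be non-zero reals and $a>0$. For $x=(x_1,x_2)\in\mathbb R^2$ and $\mu\in\mathbb C$ put $\theta_j(x)=\kappa_jx_1+\kappa_j^2x_2$, $\tau=e^{\theta_1}+ae^{\theta_2}$, $$\chi(x,\mu)=\frac{(1-\frac{\kappa_1}{\mu})e^{\theta_1}+(1-\frac{\kappa_2}{\mu})ae^{\theta_2}}{\tau},\qquad \xi(x,\mu)=\frac1\tau\Big(\frac{e^{\theta_1}}{1-\frac{\kappa_1}{\mu}}+\frac{ae^{\theta_2}}{1-\frac{\kappa_2}{\mu}}\Big),$$ $\varphi=e^{\mu x_1+\mu^2x_2}\chi$, $\psi=e^{-(\mu x_1+\mu^2x_2)}\xi$, and $$\varphi_j(x)=\varphi(x,\kappa_j)=e^{\kappa_jx_1+\kappa_j^2x_2}\chi_j(x),\qquad \psi_j(x)=\operatorname{res}_{\mu=\kappa_j}\psi(x,\mu)=e^{-(\kappa_jx_1+\kappa_j^2x_2)}\xi_j(x).$$ Let $\theta$ be the Heaviside function with $\theta(0)=\frac12$. For $\lambda=\lambda_R+i\lambda_I\in\mathbb C$ let $G$ be the Green function of $-\partial_{x_2}+\partial_{x_1}^2+2\lambda\partial_{x_1}+u_0$,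 $u_0=\frac{(\kappa_1-\kappa_2)^2}{2}\operatorname{sech}^2\frac{\theta_1-\theta_2-\ln a}{2}$, given by $\mathcal G(x,x',\lambda)=e^{\lambda(x_1-x_1')+\lambda^2(x_2-x_2')}G(x,x',\lambda)$ and $$\mathcal G=-\frac{\operatorname{sgn}(x_2-x_2')}{2\pi}\,\mathrm{p.v.}\!\!\int_{\mathbb R}\theta\big((s^2-\lambda_I^2)(x_2-x_2')\big)\varphi(x,\lambda_R+is)\psi(x',\lambda_R+is)\,ds-\theta(x_2'-x_2)\sum_{j=1}^2\theta(\lambda_R-\kappa_j)\varphi_j(x)\psi_j(x'),$$ where the principal value, taken at $s=0$, is needed only if $\lambda_R\in\{\kappa_1,\kappa_2\}$. Let $D^\times_{\kappa_j}=\{\lambda:0<|\lambda-\kappa_j|<\kappa\}$ with $\kappa=\frac12\min\{|\kappa_1|,|\kappa_2|,\kappa_2-\kappa_1\}$, and for $(p,q)\neq(0,0)$ let $\cot^{-1}\frac p{|q|}\in[0,\pi]$ be the argument of $p+i|q|$ (so for $q=0$ it is $0$ if $p>0$ and $\pi$ if $p<0$). Write $|x|=|x_1|+|x_2|$. Then: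 (1) $G(x,x',\lambda)=\overline{G(x,x',\overline\lambda)}$ for all $x,x'\in\mathbb R^2$, $\lambda\in\mathbb C$. (2) There exist functions $\mathfrak G_j(x,x')$ and $\omega_j(x,x',\lambda)$, $j=1,2$, and a constant $C$ (depending only on $\kappa_1,\kappa_2,a$) such that for all $x,x'$ with $x_2\ne x_2'$ $$G(x,x',\lambda)=\begin{cases}\mathfrak G_1(x,x')+\frac1\pi\chi_1(x)\xi_1(x')\cot^{-1}\frac{\lambda_R-\kappa_1}{|\lambda_I|}+\omega_1(x,x',\lambda),&\lambda\in D^\times_{\kappa_1},\\[2pt] \mathfrak G_2(x,x')-\frac1\pi\chi_2(x)\xi_2(x')\cot^{-1}\frac{\kappa_2-\lambda_R}{|\lambda_I|}+\omega_2(x,x',\lambda),&\lambda\in D^\times_{\kappa_2},\end{cases}$$ and, for $j=1,2$ and $\lambda\in D_{\kappa_j}^\times$, $$|\mathfrak G_j(x,x')|,\ |\omega_j(x,x',\lambda)|\le C\Big(1+\frac1{\sqrt{|x_2-x_2'|}}\Big),\qquad \Big|\frac{\omega_j(x,x',\lambda)}{\lambda-\kappa_j}\Big|\le C\Big(1+\frac1{\sqrt{|x_2-x_2'|}}\Big)(1+|x'-x|),$$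 $$\mathfrak G_2(x,x')e^{\kappa_2(x_1-x_1')+\kappa_2^2(x_2-x_2')}=e^{\kappa_1(x_1-x_1')+\kappa_1^2(x_2-x_2')}\mathfrak G_1(x,x').$$ (3) For all $x,x'$ with $x_2\neq x_2'$ and all $\alpha\in\mathbb R$, the limits $G(x,x',\kappa_2+0^+e^{i\alpha})=\lim_{r\to0^+}G(x,x',\kappa_2+re^{i\alpha})$ and $G(x,x',\kappa_1+0^+e^{i(\pi+\alpha)})$ exist and $$G(x,x',\kappa_2+0^+e^{i\alpha})e^{\kappa_2(x_1-x_1')+\kappa_2^2(x_2-x_2')}=e^{\kappa_1(x_1-x_1')+\kappa_1^2(x_2-x_2')}G(x,x',\kappa_1+0^+e^{i(\pi+\alpha)}).$$ -/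

import Mathlib

open Filter Topology MeasureTheory

noncomputable section

namespace KPGreen

/-- The phase `μ x₁ + μ² x₂`. -/
def phase (μ : ℂ) (x : ℝ × ℝ) : ℂ := μ * x.1 + μ ^ 2 * x.2

/-- `θ_j(x) = κ_j x₁ + κ_j² x₂` (at `x₃ = 0`). -/
def theta (k : ℝ) (x : ℝ × ℝ) : ℝ := k * x.1 + k ^ 2 * x.2

/-- The tau function `τ(x) = e^{θ₁} + a e^{θ₂}`. -/
def tau (κ₁ κ₂ a : ℝ) (x : ℝ × ℝ) : ℝ :=
  Real.exp (theta κ₁ x) + a * Real.exp (theta κ₂ x)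

/-- The Sato normalized eigenfunction `χ(x, μ)`. -/
def chi (κ₁ κ₂ a : ℝ) (x : ℝ × ℝ) (μ : ℂ) : ℂ :=
  ((1 - κ₁ / μ) * Real.exp (theta κ₁ x) + (1 - κ₂ / μ) * (a * Real.exp (theta κ₂ x)))
    / tau κ₁ κ₂ a x

/-- The Sato eigenfunction `φ(x, μ) = e^{μ x₁ + μ² x₂} χ(x, μ)`. -/
def phi (κ₁ κ₂ a : ℝ) (x : ℝ × ℝ) (μ : ℂ) : ℂ :=
  Complex.exp (phase μ x) * chi κ₁ κ₂ a x μ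

/-- The Sato normalized adjoint eigenfunction `ξ(x, μ)`. -/
def xi (κ₁ κ₂ a : ℝ) (x : ℝ × ℝ) (μ : ℂ) : ℂ :=
  (Real.exp (theta κ₁ x) / (1 - κ₁ / μ) + a * Real.exp (theta κ₂ x) / (1 - κ₂ / μ))
    / tau κ₁ κ₂ a x

/-- The Sato adjoint eigenfunction `ψ(x, μ) = e^{-(μ x₁ + μ² x₂)} ξ(x, μ)`. -/
def psi (κ₁ κ₂ a : ℝ) (x : ℝ × ℝ) (μ : ℂ) : ℂ :=
  Complex.exp (-phase μ x) * xi κ₁ κ₂ a x μ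

/-- The residue of `f` at a (at most simple) pole `z`. -/
def simpleResidue (f : ℂ → ℂ) (z : ℂ) : ℂ :=
  limUnder (𝓝[≠] z) fun μ => (μ - z) * f μ

/-- `φ_j(x) = φ(x, κ_j)`, with `k = κ_j`. -/
def phiAt (κ₁ κ₂ a k : ℝ) (x : ℝ × ℝ) : ℂ := phi κ₁ κ₂ a x k

/-- `ψ_j(x) = res_{μ = κ_j} ψ(x, μ)`, with `k = κ_j`. -/
def psiAt (κ₁ κ₂ a k : ℝ) (x : ℝ × ℝ) : ℂ := simpleResidue (psi κ₁ κ₂ a x) k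

/-- `χ_j(x)`, defined by `φ_j(x) = e^{κ_j x₁ + κ_j² x₂} χ_j(x)`. -/
def chiAt (κ₁ κ₂ a k : ℝ) (x : ℝ × ℝ) : ℂ := Complex.exp (-phase k x) * phiAt κ₁ κ₂ a k x

/-- `ξ_j(x)`, defined by `ψ_j(x) = e^{-(κ_j x₁ + κ_j² x₂)} ξ_j(x)`. -/
def xiAt (κ₁ κ₂ a k : ℝ) (x : ℝ × ℝ) : ℂ := Complex.exp (phase k x) * psiAt κ₁ κ₂ a k x

/-- The Heaviside function, with the symmetric value `1/2` at the jump. -/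
def heaviside (t : ℝ) : ℝ := if t < 0 then 0 else if t = 0 then 1 / 2 else 1

/-- The integral over the line, as a principal value at the origin (for an integrable
function this is the ordinary integral). -/
def pvIntegral (F : ℝ → ℂ) : ℂ :=
  limUnder (𝓝[>] (0 : ℝ)) fun ε => ∫ s in {s : ℝ | ε < |s|}, F s

/-- The continuous part `𝒢_c` of the Green function. The integrand can only be singular at
`s = 0`, and only when `Re l` is `κ₁` or `κ₂`; the principal value matters only there. -/
def calGreenC (κ₁ κ₂ a : ℝ) (x x' : ℝ × ℝ) (l : ℂ) : ℂ :=
  -(Real.sign (x.2 - x'.2) / (2 * Real.pi) : ℝ) *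
    pvIntegral fun s : ℝ =>
      (heaviside ((s ^ 2 - l.im ^ 2) * (x.2 - x'.2)) : ℂ) *
        phi κ₁ κ₂ a x (l.re + Complex.I * s) * psi κ₁ κ₂ a x' (l.re + Complex.I * s)

/-- The discrete part `𝒢_d` of the Green function. -/
def calGreenD (κ₁ κ₂ a : ℝ) (x x' : ℝ × ℝ) (l : ℂ) : ℂ :=
  -(heaviside (x'.2 - x.2) : ℂ) *
    ((heaviside (l.re - κ₁) : ℂ) * phiAt κ₁ κ₂ a κ₁ x * psiAt κ₁ κ₂ a κ₁ x' +
      (heaviside (l.re - κ₂) : ℂ) * phiAt κ₁ κ₂ a κ₂ x * psiAt κ₁ κ₂ a κ₂ x')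

/-- The Green function `𝒢` of `-∂_{x₂} + ∂_{x₁}² + u₀`. -/
def calGreen (κ₁ κ₂ a : ℝ) (x x' : ℝ × ℝ) (l : ℂ) : ℂ :=
  calGreenC κ₁ κ₂ a x x' l + calGreenD κ₁ κ₂ a x x' l

/-- The Green function `G` of `-∂_{x₂} + ∂_{x₁}² + 2 l ∂_{x₁} + u₀`:
`𝒢(x, x', l) = e^{l (x₁ - x₁') + l² (x₂ - x₂')} G(x, x', l)`. -/
def green (κ₁ κ₂ a : ℝ) (x x' : ℝ × ℝ) (l : ℂ) : ℂ :=
  Complex.exp (-phase l (x - x')) * calGreen κ₁ κ₂ a x x' l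

/-- The radius `κ = ½ min {|κ₁|, |κ₂|, κ₂ - κ₁}`. -/
def radius (κ₁ κ₂ : ℝ) : ℝ := min (min |κ₁| |κ₂|) (κ₂ - κ₁) / 2

/-- The punctured disc `D_k^×` about `k`. -/
def puncturedDisc (κ₁ κ₂ k : ℝ) : Set ℂ := {l | 0 < ‖l - k‖ ∧ ‖l - k‖ < radius κ₁ κ₂}

/-- `cot⁻¹ (p / |q|) ∈ [0, π]` for `(p, q) ≠ (0, 0)`: the angle of the point `(p, |q|)` of the
closed upper half plane. For `q = 0` it is `0` if `p > 0` and `π` if `p < 0`. -/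
def arccotAbs (p q : ℝ) : ℝ := Complex.arg (p + |q| * Complex.I)

/-- The weight `1 + 1 / √|x₂ - x₂'|`. -/
def weight (x x' : ℝ × ℝ) : ℝ := 1 + 1 / Real.sqrt |x.2 - x'.2|

/-- The distance `|x' - x| = |x₁' - x₁| + |x₂' - x₂|`. -/
def dist₁ (x x' : ℝ × ℝ) : ℝ := |x'.1 - x.1| + |x'.2 - x.2|

end KPGreen

end

open KPGreen

/-! Put X = x₁ - x₁', y = x₂ - x₂', E_j = e^{κ_j X + κ_j² y}, and write r, q for the real part and
the absolute imaginary part of λ. As a function of μ the product χ(x, μ) ξ(x', μ) is 1 + c₁/(μ - κ₁)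
+ c₂/(μ - κ₂), because the factor μ of ξ cancels the pole of χ at 0 (`chi_mul_xi`). The residues c_j
= χ_j(x) ξ_j(x') are real, at most κ₂ - κ₁ in absolute value, and satisfy c₁E₁ + c₂E₂ = 0
(`residue_expPhase_cancel`).

Folding s with -s makes the integrand real and removes its singularity at s = 0, so the principal
value is an ordinary integral. Hence 𝒢 is real and depends on λ only through r and q, which gives
(1).

For y > 0 the integral over s > q is the half-line integral minus the one over [0, q]. The former is
explicit: up to an exponential factor, the integral against a pole has an X-derivative that does not
see r - κ_j, so it is an error function plus (π/2) sign(r - κ_j) (`poleIntegral_eq`). For y < 0 the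
step functions of the discrete part supply the same signs, and their constant halves cancel by c₁E₁
+ c₂E₂ = 0. In both cases (`realGreen_eq`) 𝒢 is a λ-independent background, minus ½ Σ c_jE_j sign(r
- κ_j), plus (e^{rX + r²y}/π) ∫₀^q of the even density.

Near κ_j the singular part of that last integral is c_j arctan(q/(r - κ_j)); together with the
jumping sign it forms the angle cot⁻¹. The remainder ω_j is controlled in two regimes
(`exists_reducedGreen_bound`). If |λ - κ_j|(1 + |X| + |y|) is small, a pointwise expansion of the
segment integrand applies. Otherwise a bound of G by a multiple of 1 + 1/√|y| is enough; it rests on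
oscillatory integrals bounded uniformly in all parameters.

The two poles see the same background, so the cancellation of the residues relates the two
constants, and with cot⁻¹(-t) = π - cot⁻¹ t it also relates the limits in (3). -/

noncomputable section

namespace KPGreen

/-! ### Uniform bounds for the oscillating kernel -/

/-- The real part of `e^{isA} / (δ + is)`. -/
def oscKernel (δ A s : ℝ) : ℝ := (δ * Real.cos (s * A) + s * Real.sin (s * A)) / (δ ^ 2 + s ^ 2)

lemma oscKernel_neg_neg (δ A s : ℝ) : oscKernel (-δ) (-A) s = -oscKernel δ A s := by
  unfold oscKernel
  rw [mul_neg, Real.cos_neg, Real.sin_neg, neg_sq, ← neg_div]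
  congr 1
  ring

@[fun_prop]
lemma measurable_oscKernel (δ A : ℝ) : Measurable (oscKernel δ A) := by
  unfold oscKernel
  fun_prop

lemma continuousOn_oscKernel (δ A : ℝ) : ContinuousOn (oscKernel δ A) (Set.Ioi 0) := by
  unfold oscKernel
  apply ContinuousOn.div (by fun_prop) (by fun_prop)
  intro s hs
  have : (0 : ℝ) < s := hs
  positivity

lemma abs_cos_add_sin_le (δ A s : ℝ) :
    (δ * Real.cos (s * A) + s * Real.sin (s * A)) ^ 2 ≤ δ ^ 2 + s ^ 2 := by
  nlinarith [sq_nonneg (δ * Real.sin (s * A) - s * Real.cos (s * A)),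
    Real.sin_sq_add_cos_sq (s * A)]

lemma abs_oscKernel_le_of_sq_le {δ A s t : ℝ} (ht : 0 < t) (h : t ^ 2 ≤ δ ^ 2 + s ^ 2) :
    |oscKernel δ A s| ≤ 1 / t := by
  have hpos : 0 < δ ^ 2 + s ^ 2 := lt_of_lt_of_le (by positivity) h
  unfold oscKernel
  rw [abs_div, abs_of_pos hpos, div_le_div_iff₀ hpos ht, one_mul]
  have h1 := abs_cos_add_sin_le δ A s
  apply abs_le_of_sq_le_sq' _ hpos.le |>.2
  rw [mul_pow, sq_abs]
  nlinarith [sq_nonneg t]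

lemma abs_oscKernel_le_left {δ : ℝ} (A s : ℝ) (h : δ ≠ 0) : |oscKernel δ A s| ≤ 1 / |δ| :=
  abs_oscKernel_le_of_sq_le (abs_pos.2 h) (by rw [sq_abs]; nlinarith [sq_nonneg s])

lemma abs_oscKernel_le_right (δ A : ℝ) {s : ℝ} (h : 0 < s) : |oscKernel δ A s| ≤ 1 / s :=
  abs_oscKernel_le_of_sq_le h (by nlinarith [sq_nonneg δ])

/-- The estimate |sin(sA)| ≤ s|A| absorbs the singularity 1/s, so the bound survives at δ = 0. -/
lemma abs_sin_part_le (δ A : ℝ) {s : ℝ} (hs : 0 ≤ s) :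
    |Real.sin (s * A) * (s / (δ ^ 2 + s ^ 2))| ≤ |A| := by
  rcases hs.eq_or_lt with rfl | hs
  · simp
  have hpos : 0 < δ ^ 2 + s ^ 2 := by positivity
  rw [← mul_div_assoc, abs_div, abs_of_pos hpos, div_le_iff₀ hpos, abs_mul, abs_of_pos hs]
  have h1 : |Real.sin (s * A)| ≤ s * |A| := by
    refine (Real.abs_sin_le_abs).trans ?_
    rw [abs_mul, abs_of_pos hs]
  nlinarith [abs_nonneg A, sq_nonneg δ, mul_le_mul_of_nonneg_right h1 hs.le,
    mul_nonneg (abs_nonneg A) (sq_nonneg δ)]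

lemma abs_cos_part_le (δ A s : ℝ) :
    |Real.cos (s * A) * (δ / (δ ^ 2 + s ^ 2))| ≤ |δ| / (δ ^ 2 + s ^ 2) := by
  rw [abs_mul, abs_div, abs_of_nonneg (by positivity : 0 ≤ δ ^ 2 + s ^ 2)]
  exact mul_le_of_le_one_left (by positivity) (Real.abs_cos_le_one _)

lemma oscKernel_eq (δ A s : ℝ) : oscKernel δ A s =
    Real.cos (s * A) * (δ / (δ ^ 2 + s ^ 2)) + Real.sin (s * A) * (s / (δ ^ 2 + s ^ 2)) := by
  unfold oscKernel
  ring

lemma cauchy_le (δ s : ℝ) : |δ| / (δ ^ 2 + s ^ 2) ≤ 1 / |δ| := by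
  rcases eq_or_ne δ 0 with rfl | h
  · simp
  have : 0 < |δ| := abs_pos.2 h
  rw [div_le_div_iff₀ (by positivity) this, one_mul]
  nlinarith [sq_abs δ, sq_nonneg s]

/-- A bound for the kernel, uniform in `s ≥ 0`, also for `δ = 0`. -/
lemma abs_oscKernel_le (δ A : ℝ) {s : ℝ} (hs : 0 ≤ s) : |oscKernel δ A s| ≤ 1 / |δ| + |A| := by
  rw [oscKernel_eq]
  exact (abs_add_le _ _).trans (add_le_add ((abs_cos_part_le δ A s).trans (cauchy_le δ s))
    (abs_sin_part_le δ A hs))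

lemma intervalIntegrable_of_bounded {f : ℝ → ℝ} (hf : Measurable f) {C a b : ℝ} (ha : 0 ≤ a)
    (hb : 0 ≤ b) (h : ∀ s, 0 ≤ s → |f s| ≤ C) : IntervalIntegrable f volume a b := by
  rw [intervalIntegrable_iff]
  refine Measure.integrableOn_of_bounded (M := C) (by simp [Set.uIoc]) hf.aestronglyMeasurable ?_
  refine (ae_restrict_iff' measurableSet_uIoc).2 (Eventually.of_forall fun s hs => h s ?_)
  exact (le_min ha hb).trans hs.1.le

lemma intervalIntegrable_oscKernel (δ A : ℝ) {a b : ℝ} (ha : 0 ≤ a) (hb : 0 ≤ b) :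
    IntervalIntegrable (oscKernel δ A) volume a b :=
  intervalIntegrable_of_bounded (measurable_oscKernel δ A) ha hb
    fun _ hs => abs_oscKernel_le δ A hs

lemma intervalIntegrable_cauchy (δ : ℝ) {a b : ℝ} (ha : 0 ≤ a) (hb : 0 ≤ b) :
    IntervalIntegrable (fun s => δ / (δ ^ 2 + s ^ 2)) volume a b := by
  refine intervalIntegrable_of_bounded (C := 1 / |δ|) (by fun_prop) ha hb fun s _ => ?_
  rw [abs_div, abs_of_nonneg (by positivity : 0 ≤ δ ^ 2 + s ^ 2)]
  exact cauchy_le δ s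

/-- For δ = 0 both sides vanish, since division by zero gives 0. -/
lemma integral_cauchy (δ a b : ℝ) :
    ∫ s in a..b, δ / (δ ^ 2 + s ^ 2) = Real.arctan (b / δ) - Real.arctan (a / δ) := by
  rcases eq_or_ne δ 0 with rfl | h
  · simp
  refine intervalIntegral.integral_eq_sub_of_hasDerivAt (f := fun s => Real.arctan (s / δ))
    (fun s _ => ?_) ?_
  · have := ((hasDerivAt_id s).div_const δ).arctan
    refine HasDerivAt.congr_deriv this ?_
    simp only [id]
    field_simp
  · refine Continuous.intervalIntegrable ?_ _ _
    refine Continuous.div (by fun_prop) (by fun_prop) fun s => ?_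
    have := sq_nonneg s
    positivity

lemma abs_integral_cos_part_le (δ A : ℝ) {a b : ℝ} (ha : 0 ≤ a) (hab : a ≤ b) :
    |∫ s in a..b, Real.cos (s * A) * (δ / (δ ^ 2 + s ^ 2))| ≤ Real.pi := by
  have h1 : |∫ s in a..b, Real.cos (s * A) * (δ / (δ ^ 2 + s ^ 2))| ≤
      ∫ s in a..b, |δ| / (|δ| ^ 2 + s ^ 2) := by
    rw [← Real.norm_eq_abs]
    refine intervalIntegral.norm_integral_le_of_norm_le hab
      (Eventually.of_forall fun s _ => ?_) (intervalIntegrable_cauchy |δ| ha (ha.trans hab))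
    rw [sq_abs]
    exact abs_cos_part_le δ A s
  refine h1.trans ?_
  rw [integral_cauchy]
  linarith [Real.arctan_lt_pi_div_two (b / |δ|), Real.neg_pi_div_two_lt_arctan (a / |δ|)]

lemma intervalIntegrable_sin_part (δ A : ℝ) {a b : ℝ} (ha : 0 ≤ a) (hb : 0 ≤ b) :
    IntervalIntegrable (fun s => Real.sin (s * A) * (s / (δ ^ 2 + s ^ 2))) volume a b :=
  intervalIntegrable_of_bounded (by fun_prop) ha hb fun _ hs => abs_sin_part_le δ A hs

lemma intervalIntegrable_cos_part (δ A : ℝ) {a b : ℝ} (ha : 0 ≤ a) (hb : 0 ≤ b) :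
    IntervalIntegrable (fun s => Real.cos (s * A) * (δ / (δ ^ 2 + s ^ 2))) volume a b :=
  intervalIntegrable_of_bounded (by fun_prop) ha hb fun s _ =>
    (abs_cos_part_le δ A s).trans (cauchy_le δ s)

lemma abs_integral_sin_part_near_le (δ A : ℝ) {a b : ℝ} (ha : 0 ≤ a) (hab : a ≤ b)
    (hb : b * |A| ≤ 1) :
    |∫ s in a..b, Real.sin (s * A) * (s / (δ ^ 2 + s ^ 2))| ≤ 1 := by
  have h := intervalIntegral.norm_integral_le_of_norm_le_const (a := a) (b := b) (C := |A|)
    (f := fun s => Real.sin (s * A) * (s / (δ ^ 2 + s ^ 2))) fun s hs => by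
      rw [Set.uIoc_of_le hab] at hs
      exact abs_sin_part_le δ A (ha.trans hs.1.le)
  refine h.trans ?_
  rw [abs_of_nonneg (sub_nonneg.2 hab)]
  nlinarith [mul_nonneg ha (abs_nonneg A)]

/-- Integration by parts in the oscillation: for s ≥ a ≥ 1/|A| each of the two boundary terms is at
most 1, and the derivative of s/(δ² + s²) is at most s⁻² in absolute value, so the remaining
integral is at most 1/(a|A|) ≤ 1. -/
lemma abs_integral_sin_part_far_le (δ A : ℝ) {a b : ℝ} (ha : 0 < a) (hab : a ≤ b)
    (haA : 1 ≤ a * |A|) :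
    |∫ s in a..b, Real.sin (s * A) * (s / (δ ^ 2 + s ^ 2))| ≤ 3 := by
  have hA : 0 < |A| := by
    by_contra hc
    have : |A| = 0 := le_antisymm (not_lt.1 hc) (abs_nonneg A)
    rw [this] at haA
    linarith
  have hA0 : A ≠ 0 := abs_pos.1 hA
  have hm : ∀ s ∈ Set.uIcc a b, HasDerivAt (fun s => s / (δ ^ 2 + s ^ 2))
      ((δ ^ 2 - s ^ 2) / (δ ^ 2 + s ^ 2) ^ 2) s := by
    intro s hs
    rw [Set.uIcc_of_le hab] at hs
    have hs0 : 0 < s := ha.trans_le hs.1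
    have hne : δ ^ 2 + s ^ 2 ≠ 0 := by positivity
    have := (hasDerivAt_id s).div (((hasDerivAt_id s).pow 2).const_add (δ ^ 2)) hne
    refine HasDerivAt.congr_deriv this ?_
    simp only [id, Pi.pow_apply]
    field_simp
    norm_num
    ring
  have hc : ∀ s ∈ Set.uIcc a b, HasDerivAt (fun s => -Real.cos (s * A) / A)
      (Real.sin (s * A)) s := by
    intro s _
    have := (((hasDerivAt_id s).mul_const A).cos.neg).div_const A
    refine HasDerivAt.congr_deriv this ?_
    simp only [id]
    field_simp
  have hcont : ContinuousOn (fun s : ℝ => (δ ^ 2 - s ^ 2) / (δ ^ 2 + s ^ 2) ^ 2)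
      (Set.uIcc a b) := by
    apply ContinuousOn.div (by fun_prop) (by fun_prop)
    intro s hs
    rw [Set.uIcc_of_le hab] at hs
    have hs0 : 0 < s := ha.trans_le hs.1
    positivity
  have hparts := intervalIntegral.integral_mul_deriv_eq_deriv_mul hm hc
    hcont.intervalIntegrable (Continuous.intervalIntegrable (by fun_prop) _ _)
  have hsq : IntervalIntegrable (fun s : ℝ => 1 / |A| * s ^ (-2 : ℤ)) volume a b := by
    refine ContinuousOn.intervalIntegrable ?_
    refine ContinuousOn.mul (by fun_prop) (ContinuousOn.zpow₀ (by fun_prop) _ ?_)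
    intro s hs
    rw [Set.uIcc_of_le hab] at hs
    exact Or.inl (ha.trans_le hs.1).ne'
  have hint : |∫ s in a..b, (δ ^ 2 - s ^ 2) / (δ ^ 2 + s ^ 2) ^ 2 * (-Real.cos (s * A) / A)| ≤
      ∫ s in a..b, 1 / |A| * s ^ (-2 : ℤ) := by
    rw [← Real.norm_eq_abs]
    refine intervalIntegral.norm_integral_le_of_norm_le hab
      (Eventually.of_forall fun s hs => ?_) hsq
    have hs0 : 0 < s := ha.trans hs.1
    rw [Real.norm_eq_abs, abs_mul, abs_div, abs_div, abs_neg, mul_comm]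
    refine mul_le_mul ?_ ?_ (by positivity) (by positivity)
    · exact div_le_div_of_nonneg_right (Real.abs_cos_le_one _) hA.le
    · rw [zpow_neg, abs_of_nonneg (by positivity : 0 ≤ (δ ^ 2 + s ^ 2) ^ 2), ← one_div,
        div_le_div_iff₀ (by positivity) (by positivity)]
      have h1 : |δ ^ 2 - s ^ 2| ≤ δ ^ 2 + s ^ 2 :=
        abs_le.2 ⟨by nlinarith [sq_nonneg δ], by nlinarith [sq_nonneg s]⟩
      have h2 : s ^ 2 ≤ δ ^ 2 + s ^ 2 := by nlinarith [sq_nonneg δ]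
      have h3 := mul_le_mul h1 h2 (sq_nonneg s) (by positivity)
      norm_cast
      nlinarith
  have hval : ∫ s in a..b, 1 / |A| * s ^ (-2 : ℤ) ≤ 1 := by
    rw [intervalIntegral.integral_const_mul, integral_zpow (Or.inr ⟨by norm_num, fun h => by
      rw [Set.uIcc_of_le hab] at h; exact absurd h.1 (not_le.2 ha)⟩)]
    have hb : 0 < b := ha.trans_le hab
    norm_num
    have h1 : a⁻¹ ≤ |A| := by
      rw [inv_le_iff_one_le_mul₀ ha, mul_comm]
      exact haA
    have h2 : 0 < b⁻¹ := inv_pos.2 hb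
    rw [inv_mul_le_iff₀ hA]
    linarith
  have hbd : ∀ s, a ≤ s → |s / (δ ^ 2 + s ^ 2) * (-Real.cos (s * A) / A)| ≤ 1 := by
    intro s hs
    have hs0 : 0 < s := ha.trans_le hs
    rw [abs_mul, abs_div, abs_div, abs_neg, abs_of_pos hs0,
      abs_of_nonneg (by positivity : 0 ≤ δ ^ 2 + s ^ 2)]
    have h1 : s / (δ ^ 2 + s ^ 2) ≤ |A| := by
      rw [div_le_iff₀ (by positivity)]
      have : 1 ≤ s * |A| := haA.trans (mul_le_mul_of_nonneg_right hs hA.le)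
      nlinarith [mul_nonneg hA.le (sq_nonneg δ), mul_le_mul_of_nonneg_left this hs0.le]
    have h2 : |Real.cos (s * A)| / |A| ≤ 1 / |A| :=
      div_le_div_of_nonneg_right (Real.abs_cos_le_one _) hA.le
    calc _ ≤ |A| * (1 / |A|) := mul_le_mul h1 h2 (by positivity) hA.le
      _ = 1 := by field_simp
  have heq : ∫ s in a..b, Real.sin (s * A) * (s / (δ ^ 2 + s ^ 2)) =
      ∫ s in a..b, s / (δ ^ 2 + s ^ 2) * Real.sin (s * A) := by simp only [mul_comm]
  rw [heq, hparts]
  refine (abs_sub _ _).trans ?_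
  refine (add_le_add (abs_sub _ _) le_rfl).trans ?_
  linarith [hbd a le_rfl, hbd b hab]

/-- The interval is cut at s = 1/|A|: before it the trivial bound gives 1, after it oscillation
gives 3. -/
lemma abs_integral_sin_part_le (δ A : ℝ) {a b : ℝ} (ha : 0 ≤ a) (hab : a ≤ b) :
    |∫ s in a..b, Real.sin (s * A) * (s / (δ ^ 2 + s ^ 2))| ≤ 4 := by
  rcases le_total (b * |A|) 1 with hb | hb
  · linarith [abs_integral_sin_part_near_le δ A ha hab hb]
  have hA : 0 < |A| := by
    by_contra hc
    have : |A| = 0 := le_antisymm (not_lt.1 hc) (abs_nonneg A)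
    rw [this] at hb
    linarith
  rcases le_total 1 (a * |A|) with h | h
  · have ha' : 0 < a := by
      by_contra hc
      have : a = 0 := le_antisymm (not_lt.1 hc) ha
      rw [this] at h
      linarith
    linarith [abs_integral_sin_part_far_le δ A ha' hab h]
  have hmid : 1 / |A| * |A| = 1 := by field_simp
  have hac : a ≤ 1 / |A| := (le_div_iff₀ hA).2 h
  have hcb : 1 / |A| ≤ b := (div_le_iff₀ hA).2 hb
  have hc : 0 < 1 / |A| := by positivity
  rw [← intervalIntegral.integral_add_adjacent_intervals
    (intervalIntegrable_sin_part δ A ha hc.le)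
    (intervalIntegrable_sin_part δ A hc.le (hc.le.trans hcb))]
  refine (abs_add_le _ _).trans ?_
  linarith [abs_integral_sin_part_near_le δ A ha hac hmid.le,
    abs_integral_sin_part_far_le δ A hc hcb hmid.ge]

lemma abs_integral_oscKernel_le (δ A : ℝ) {a b : ℝ} (ha : 0 ≤ a) (hab : a ≤ b) :
    |∫ s in a..b, oscKernel δ A s| ≤ 8 := by
  simp only [oscKernel_eq]
  rw [intervalIntegral.integral_add (intervalIntegrable_cos_part δ A ha (ha.trans hab))
    (intervalIntegrable_sin_part δ A ha (ha.trans hab))]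
  refine (abs_add_le _ _).trans ?_
  linarith [abs_integral_cos_part_le δ A ha hab, abs_integral_sin_part_le δ A ha hab,
    Real.pi_le_four]

/-- A Gaussian weight with values in `[0, 1]` does not spoil the uniform bound for the integrals
of the kernel. -/
lemma abs_integral_gaussian_mul_oscKernel_le (δ A y p : ℝ) {a b : ℝ} (ha : 0 ≤ a) (hab : a ≤ b)
    (hp : ∀ s ∈ Set.Icc a b, 0 ≤ (s ^ 2 - p) * y) :
    |∫ s in a..b, Real.exp (-((s ^ 2 - p) * y)) * oscKernel δ A s| ≤ 16 := by
  set F : ℝ → ℝ := fun t => ∫ s in a..t, oscKernel δ A s with hF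
  have hN : IntervalIntegrable (oscKernel δ A) volume a b :=
    intervalIntegrable_oscKernel δ A ha (ha.trans hab)
  have hFc : ContinuousOn F (Set.uIcc a b) :=
    intervalIntegral.continuousOn_primitive_interval (by
      rw [Set.uIcc_of_le hab]
      exact (intervalIntegrable_iff_integrableOn_Icc_of_le hab).1 hN)
  have hd : ∀ s, HasDerivAt (fun s : ℝ => Real.exp (-((s ^ 2 - p) * y)))
      (-(2 * s * y) * Real.exp (-((s ^ 2 - p) * y))) s := by
    intro s
    have := (((((hasDerivAt_id s).pow 2).sub_const p).mul_const y).neg).exp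
    refine HasDerivAt.congr_deriv this ?_
    simp only [id, Pi.neg_apply, Pi.pow_apply]
    norm_num
    ring
  have hdi : IntervalIntegrable (fun s : ℝ => -(2 * s * y) * Real.exp (-((s ^ 2 - p) * y)))
      volume a b := Continuous.intervalIntegrable (by fun_prop) _ _
  -- Only interior points are used: for δ = 0 and A ≠ 0 the kernel jumps at s = 0.
  have hFd : ∀ s ∈ Set.Ioo (min a b) (max a b), HasDerivAt F (oscKernel δ A s) s := by
    intro s hs
    rw [min_eq_left hab, max_eq_right hab] at hs
    have hs0 : 0 < s := ha.trans_lt hs.1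
    refine intervalIntegral.integral_hasDerivAt_right
      (intervalIntegrable_oscKernel δ A ha hs0.le) ?_ ?_
    · exact (measurable_oscKernel δ A).stronglyMeasurable.stronglyMeasurableAtFilter
    · exact (continuousOn_oscKernel δ A).continuousAt (Ioi_mem_nhds hs0)
  have hparts := intervalIntegral.integral_mul_deriv_eq_deriv_mul_of_hasDerivAt
    (u := fun s : ℝ => Real.exp (-((s ^ 2 - p) * y))) (v := F)
    (by fun_prop) hFc (fun s _ => hd s) hFd hdi hN
  rw [hparts]
  have hFb : ∀ s ∈ Set.Icc a b, |F s| ≤ 8 := fun s hs => abs_integral_oscKernel_le δ A ha hs.1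
  have hFa : F a = 0 := by simp [hF]
  have he : ∀ s ∈ Set.Icc a b, Real.exp (-((s ^ 2 - p) * y)) ≤ 1 := fun s hs =>
    Real.exp_le_one_iff.2 (neg_nonpos.2 (hp s hs))
  have hb' : b ∈ Set.Icc a b := ⟨hab, le_rfl⟩
  have ha' : a ∈ Set.Icc a b := ⟨le_rfl, hab⟩
  have hmain : |∫ s in a..b, -(2 * s * y) * Real.exp (-((s ^ 2 - p) * y)) * F s| ≤ 8 := by
    have hone : |∫ s in a..b, -(2 * s * y) * Real.exp (-((s ^ 2 - p) * y))| ≤ 1 := by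
      rw [intervalIntegral.integral_eq_sub_of_hasDerivAt (fun s _ => hd s) hdi, abs_le]
      constructor <;> linarith [he a ha', he b hb', Real.exp_pos (-((a ^ 2 - p) * y)),
        Real.exp_pos (-((b ^ 2 - p) * y))]
    -- The Gaussian is monotone for s ≥ 0, so its total variation is the difference of its end
    -- values, which lie in (0, 1]. Thus integration by parts costs 8 for the boundary and 8 for the
    -- integral.
    have habs : ∫ s in a..b, |2 * s * y| * Real.exp (-((s ^ 2 - p) * y)) =
        |∫ s in a..b, -(2 * s * y) * Real.exp (-((s ^ 2 - p) * y))| := by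
      rcases le_total 0 y with hy | hy
      · have : ∀ s ∈ Set.uIcc a b, |2 * s * y| * Real.exp (-((s ^ 2 - p) * y)) =
            -(-(2 * s * y) * Real.exp (-((s ^ 2 - p) * y))) := by
          intro s hs
          rw [Set.uIcc_of_le hab] at hs
          have := ha.trans hs.1
          rw [abs_of_nonneg (by positivity)]
          ring
        rw [intervalIntegral.integral_congr this, intervalIntegral.integral_neg, abs_of_nonpos]
        refine neg_nonneg.1 ?_
        rw [← intervalIntegral.integral_neg, ← intervalIntegral.integral_congr this]
        exact intervalIntegral.integral_nonneg hab fun s _ => by positivity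
      · have : ∀ s ∈ Set.uIcc a b, |2 * s * y| * Real.exp (-((s ^ 2 - p) * y)) =
            (-(2 * s * y) * Real.exp (-((s ^ 2 - p) * y))) := by
          intro s hs
          rw [Set.uIcc_of_le hab] at hs
          have := ha.trans hs.1
          rw [abs_of_nonpos (mul_nonpos_of_nonneg_of_nonpos (by positivity) hy)]
        rw [intervalIntegral.integral_congr this, abs_of_nonneg]
        rw [← intervalIntegral.integral_congr this]
        exact intervalIntegral.integral_nonneg hab fun s _ => by positivity
    have hle : |∫ s in a..b, -(2 * s * y) * Real.exp (-((s ^ 2 - p) * y)) * F s| ≤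
        ∫ s in a..b, |2 * s * y| * Real.exp (-((s ^ 2 - p) * y)) * 8 := by
      rw [← Real.norm_eq_abs]
      refine intervalIntegral.norm_integral_le_of_norm_le hab
        (Eventually.of_forall fun s hs => ?_) (Continuous.intervalIntegrable (by fun_prop) _ _)
      rw [Real.norm_eq_abs, abs_mul, abs_mul, abs_neg, Real.abs_exp]
      exact mul_le_mul_of_nonneg_left (hFb s ⟨hs.1.le, hs.2⟩) (by positivity)
    rw [intervalIntegral.integral_mul_const, habs] at hle
    linarith
  rw [hFa, mul_zero, sub_zero]
  refine (abs_sub _ _).trans ?_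
  have hbb : |Real.exp (-((b ^ 2 - p) * y)) * F b| ≤ 8 := by
    rw [abs_mul, Real.abs_exp]
    calc _ ≤ 1 * 8 := mul_le_mul (he b hb') (hFb b hb') (abs_nonneg _) zero_le_one
      _ = 8 := by norm_num
  linarith

/-! ### Gaussian integrals and the pole integral in closed form -/

lemma integrableOn_gaussian {y : ℝ} (hy : 0 < y) (S : Set ℝ) :
    IntegrableOn (fun s : ℝ => Real.exp (-(s ^ 2 * y))) S := by
  refine Integrable.integrableOn ?_
  simpa only [neg_mul, mul_comm] using integrable_exp_neg_mul_sq hy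

/-- A Gaussian times a function that is bounded on the positive half line is integrable there. -/
lemma integrableOn_gaussian_mul {y : ℝ} (hy : 0 < y) {f : ℝ → ℝ} (hf : Measurable f) {C a : ℝ}
    (ha : 0 ≤ a) (h : ∀ s, 0 ≤ s → |f s| ≤ C) :
    IntegrableOn (fun s : ℝ => Real.exp (-(s ^ 2 * y)) * f s) (Set.Ioi a) := by
  simp only [mul_comm (Real.exp _)]
  refine Integrable.bdd_mul (c := C) (integrableOn_gaussian hy _) hf.aestronglyMeasurable ?_
  exact (ae_restrict_iff' measurableSet_Ioi).2
    (Eventually.of_forall fun s hs => h s (ha.trans (le_of_lt hs)))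

/-- Real part of the Fourier transform of the Gaussian, halved by evenness. -/
lemma integral_gaussian_cos {y : ℝ} (hy : 0 < y) (A : ℝ) :
    ∫ s in Set.Ioi (0 : ℝ), Real.exp (-(s ^ 2 * y)) * Real.cos (s * A) =
      Real.sqrt (Real.pi / y) / 2 * Real.exp (-(A ^ 2 / (4 * y))) := by
  have h1 := fourierIntegral_gaussian (b := y) (by simpa using hy) A
  have habs : (∫ s : ℝ, Real.exp (-(s ^ 2 * y)) * Real.cos (s * A)) =
      2 * ∫ s in Set.Ioi (0 : ℝ), Real.exp (-(s ^ 2 * y)) * Real.cos (s * A) := by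
    rw [← integral_comp_abs (f := fun s => Real.exp (-(s ^ 2 * y)) * Real.cos (s * A))]
    refine integral_congr_ae (Eventually.of_forall fun s => ?_)
    simp only [sq_abs]
    rcases abs_choice s with h | h <;> simp [h]
  have hre : ∀ s : ℝ, (Complex.exp (Complex.I * A * s) * Complex.exp (-y * s ^ 2)).re =
      Real.exp (-(s ^ 2 * y)) * Real.cos (s * A) := by
    intro s
    have e1 : Complex.exp (-y * s ^ 2) = ((Real.exp (-(s ^ 2 * y)) : ℝ) : ℂ) := by
      push_cast; ring_nf
    have e2 : Complex.I * A * s = ((s * A : ℝ) : ℂ) * Complex.I := by push_cast; ring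
    rw [e1, e2, Complex.re_mul_ofReal, Complex.exp_ofReal_mul_I_re, mul_comm]
  have hint : Integrable fun s : ℝ =>
      Complex.exp (Complex.I * A * s) * Complex.exp (-y * s ^ 2) := by
    refine Integrable.bdd_mul (c := 1) (by
      simpa using integrable_cexp_neg_mul_sq (b := y) (by simpa using hy))
      (by fun_prop) (Eventually.of_forall fun s => ?_)
    have e2 : Complex.I * A * s = ((s * A : ℝ) : ℂ) * Complex.I := by push_cast; ring
    rw [e2, Complex.norm_exp_ofReal_mul_I]
  have h2 := congrArg Complex.re h1
  have h3 : (∫ s : ℝ, Complex.exp (Complex.I * A * s) * Complex.exp (-y * s ^ 2)).re =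
      ∫ s : ℝ, Real.exp (-(s ^ 2 * y)) * Real.cos (s * A) := by
    have := integral_re hint
    simp only [RCLike.re_to_complex, hre] at this
    exact this.symm
  rw [h3, habs] at h2
  have h4 : ((Real.pi / y : ℂ) ^ (1 / 2 : ℂ) * Complex.exp (-(A : ℂ) ^ 2 / (4 * y))) =
      ((Real.sqrt (Real.pi / y) * Real.exp (-(A ^ 2 / (4 * y))) : ℝ) : ℂ) := by
    rw [Real.sqrt_eq_rpow]
    push_cast
    rw [Complex.ofReal_cpow (by positivity)]
    push_cast
    rw [neg_div]
  rw [h4, Complex.ofReal_re] at h2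
  linarith

/-- A multiple of the error function, with limits `±π` at `±∞`. -/
def erfPi (y Z : ℝ) : ℝ :=
  Real.sqrt (Real.pi / y) * ∫ t in (0 : ℝ)..Z, Real.exp (-(t ^ 2 / (4 * y)))

lemma hasDerivAt_erfPi (y Z : ℝ) :
    HasDerivAt (erfPi y) (Real.sqrt (Real.pi / y) * Real.exp (-(Z ^ 2 / (4 * y)))) Z := by
  unfold erfPi
  refine HasDerivAt.const_mul _ ?_
  have hc : Continuous fun t : ℝ => Real.exp (-(t ^ 2 / (4 * y))) := by fun_prop
  exact intervalIntegral.integral_hasDerivAt_right (hc.intervalIntegrable _ _)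
    hc.stronglyMeasurable.stronglyMeasurableAtFilter hc.continuousAt

lemma erfPi_neg (y Z : ℝ) : erfPi y (-Z) = -erfPi y Z := by
  unfold erfPi
  rw [← mul_neg, ← intervalIntegral.integral_symm]
  congr 1
  have := intervalIntegral.integral_comp_neg (a := 0) (b := Z)
    (fun t : ℝ => Real.exp (-(t ^ 2 / (4 * y))))
  rw [neg_zero] at this
  rw [intervalIntegral.integral_symm, ← this, intervalIntegral.integral_symm Z 0]
  simp

lemma sqrt_mul_sqrt_gaussian {y : ℝ} (hy : 0 < y) :
    Real.sqrt (Real.pi / y) * (Real.sqrt (Real.pi / (1 / (4 * y))) / 2) = Real.pi := by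
  have hpi := Real.pi_pos
  rw [← mul_div_assoc, ← Real.sqrt_mul (by positivity)]
  have : Real.pi / y * (Real.pi / (1 / (4 * y))) = (2 * Real.pi) ^ 2 := by
    field_simp
    ring
  rw [this, Real.sqrt_sq (by positivity)]
  ring

lemma tendsto_erfPi_atTop {y : ℝ} (hy : 0 < y) : Tendsto (erfPi y) atTop (𝓝 Real.pi) := by
  have h1 := integral_gaussian_Ioi (1 / (4 * y))
  have h2 : ∀ t : ℝ, -(1 / (4 * y)) * t ^ 2 = -(t ^ 2 / (4 * y)) := fun t => by ring
  simp only [h2] at h1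
  have hint : IntegrableOn (fun t : ℝ => Real.exp (-(t ^ 2 / (4 * y)))) (Set.Ioi 0) := by
    have := integrableOn_gaussian (y := 1 / (4 * y)) (by positivity) (Set.Ioi 0)
    simpa only [mul_one_div] using this
  have h3 := intervalIntegral_tendsto_integral_Ioi 0 hint tendsto_id
  have h4 := h3.const_mul (Real.sqrt (Real.pi / y))
  rw [h1, sqrt_mul_sqrt_gaussian hy] at h4
  exact h4

lemma monotone_erfPi (y : ℝ) : Monotone (erfPi y) := by
  refine monotone_of_hasDerivAt_nonneg (hasDerivAt_erfPi y) fun Z => ?_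
  simp only [Pi.zero_apply]
  positivity

lemma abs_erfPi_le {y : ℝ} (hy : 0 < y) (Z : ℝ) : |erfPi y Z| ≤ Real.pi := by
  have h : ∀ Z, erfPi y Z ≤ Real.pi := fun Z =>
    (monotone_erfPi y).ge_of_tendsto (tendsto_erfPi_atTop hy) Z
  refine abs_le.2 ⟨?_, h Z⟩
  have := h (-Z)
  rw [erfPi_neg] at this
  linarith

/-- The Gaussian integral of the kernel, normalized so that its derivative in `Z` does not depend
on `δ`. -/
def poleIntegral (y δ Z : ℝ) : ℝ :=
  Real.exp (δ * Z + δ ^ 2 * y) *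
    ∫ s in Set.Ioi (0 : ℝ), Real.exp (-(s ^ 2 * y)) * oscKernel δ (Z + 2 * δ * y) s

lemma poleIntegral_neg_neg (y δ Z : ℝ) : poleIntegral y (-δ) (-Z) = -poleIntegral y δ Z := by
  unfold poleIntegral
  have : -Z + 2 * -δ * y = -(Z + 2 * δ * y) := by ring
  rw [this, neg_mul_neg, neg_sq, ← mul_neg, ← integral_neg]
  simp only [oscKernel_neg_neg, mul_neg]

/-- The function is the real part of an exponential in (δ + is)Z divided by δ + is, so
differentiation in Z cancels the denominator. -/
lemma hasDerivAt_exp_mul_oscKernel (δ y Z : ℝ) {s : ℝ} (hs : 0 < s) :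
    HasDerivAt (fun Z => Real.exp (δ * Z + δ ^ 2 * y) * oscKernel δ (Z + 2 * δ * y) s)
      (Real.exp (δ * Z + δ ^ 2 * y) * Real.cos (s * (Z + 2 * δ * y))) Z := by
  unfold oscKernel
  have hA : HasDerivAt (fun Z : ℝ => s * (Z + 2 * δ * y)) s Z := by
    simpa using ((hasDerivAt_id Z).add_const (2 * δ * y)).const_mul s
  have hE : HasDerivAt (fun Z : ℝ => Real.exp (δ * Z + δ ^ 2 * y))
      (Real.exp (δ * Z + δ ^ 2 * y) * δ) Z := by
    simpa using (((hasDerivAt_id Z).const_mul δ).add_const (δ ^ 2 * y)).exp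
  have := hE.mul (((hA.cos.const_mul δ).add (hA.sin.const_mul s)).div_const (δ ^ 2 + s ^ 2))
  refine HasDerivAt.congr_deriv this ?_
  have hne : δ ^ 2 + s ^ 2 ≠ 0 := by positivity
  simp only [Pi.add_apply]
  field_simp
  ring

lemma hasDerivAt_poleIntegral {y : ℝ} (hy : 0 < y) (δ Z : ℝ) :
    HasDerivAt (poleIntegral y δ)
      (1 / 2 * (Real.sqrt (Real.pi / y) * Real.exp (-(Z ^ 2 / (4 * y))))) Z := by
  have hfun : poleIntegral y δ = fun Z => ∫ s in Set.Ioi (0 : ℝ), Real.exp (-(s ^ 2 * y)) *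
      (Real.exp (δ * Z + δ ^ 2 * y) * oscKernel δ (Z + 2 * δ * y) s) := by
    funext Z
    unfold poleIntegral
    rw [← integral_const_mul]
    congr 1 with s
    ring
  have hd := (hasDerivAt_integral_of_dominated_loc_of_deriv_le (𝕜 := ℝ)
    (μ := volume.restrict (Set.Ioi (0 : ℝ))) (x₀ := Z) (s := Metric.ball Z 1)
    (bound := fun s => Real.exp (-(s ^ 2 * y)) * Real.exp (|δ| * (|Z| + 1) + δ ^ 2 * y))
    (F := fun Z s => Real.exp (-(s ^ 2 * y)) *
      (Real.exp (δ * Z + δ ^ 2 * y) * oscKernel δ (Z + 2 * δ * y) s))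
    (F' := fun Z s => Real.exp (-(s ^ 2 * y)) *
      (Real.exp (δ * Z + δ ^ 2 * y) * Real.cos (s * (Z + 2 * δ * y))))
    (Metric.ball_mem_nhds Z one_pos) ?_ ?_ ?_ ?_ ?_ ?_).2
  · rw [hfun]
    refine HasDerivAt.congr_deriv hd ?_
    have : ∀ s : ℝ, Real.exp (-(s ^ 2 * y)) *
        (Real.exp (δ * Z + δ ^ 2 * y) * Real.cos (s * (Z + 2 * δ * y))) =
        Real.exp (δ * Z + δ ^ 2 * y) *
          (Real.exp (-(s ^ 2 * y)) * Real.cos (s * (Z + 2 * δ * y))) := fun s => by ring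
    simp only [this]
    rw [integral_const_mul, integral_gaussian_cos hy]
    -- Completing the square removes δ from the derivative.
    have : Real.exp (-(Z ^ 2 / (4 * y))) = Real.exp (δ * Z + δ ^ 2 * y) *
        Real.exp (-((Z + 2 * δ * y) ^ 2 / (4 * y))) := by
      rw [← Real.exp_add]
      congr 1
      field_simp
      ring
    rw [this]
    ring
  · refine Eventually.of_forall fun Z => Measurable.aestronglyMeasurable ?_
    fun_prop
  · refine integrableOn_gaussian_mul hy (by fun_prop) le_rfl
      (C := Real.exp (δ * Z + δ ^ 2 * y) * (1 / |δ| + |Z + 2 * δ * y|)) fun s hs => ?_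
    rw [abs_mul, Real.abs_exp]
    exact mul_le_mul_of_nonneg_left (abs_oscKernel_le _ _ hs) (Real.exp_pos _).le
  · exact Measurable.aestronglyMeasurable (by fun_prop)
  · refine Eventually.of_forall fun s W hW => ?_
    rw [Real.norm_eq_abs, abs_mul, abs_mul, Real.abs_exp, Real.abs_exp]
    refine mul_le_mul_of_nonneg_left ?_ (Real.exp_pos _).le
    refine (mul_le_of_le_one_right (Real.exp_pos _).le (Real.abs_cos_le_one _)).trans ?_
    refine Real.exp_le_exp.2 (add_le_add ?_ le_rfl)
    refine (le_abs_self _).trans ?_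
    rw [abs_mul]
    refine mul_le_mul_of_nonneg_left ?_ (abs_nonneg δ)
    rw [Metric.mem_ball, Real.dist_eq] at hW
    have := abs_add_le (W - Z) Z
    rw [sub_add_cancel] at this
    linarith
  · exact (integrableOn_gaussian hy _).mul_const _
  · refine (ae_restrict_iff' measurableSet_Ioi).2 (Eventually.of_forall fun s hs W _ => ?_)
    exact (hasDerivAt_exp_mul_oscKernel δ y W hs).const_mul _

lemma poleIntegral_eq_add {y : ℝ} (hy : 0 < y) (δ Z : ℝ) :
    poleIntegral y δ Z = poleIntegral y δ 0 + erfPi y Z / 2 := by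
  have hd : ∀ Z, HasDerivAt (fun Z => poleIntegral y δ Z - 1 / 2 * erfPi y Z) 0 Z := by
    intro Z
    refine HasDerivAt.congr_deriv
      ((hasDerivAt_poleIntegral hy δ Z).sub ((hasDerivAt_erfPi y Z).const_mul (1 / 2))) ?_
    ring
  have := is_const_of_deriv_eq_zero (fun Z => (hd Z).differentiableAt) (fun Z => (hd Z).deriv) Z 0
  have h0 : erfPi y 0 = 0 := by simp [erfPi]
  rw [h0] at this
  linarith

/-- For δ > 0 the kernel is at most 1/δ, so the integral stays bounded while the prefactor e^{δZ}
decays. This fixes the constant of integration. -/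
lemma tendsto_poleIntegral_atBot {y δ : ℝ} (hy : 0 < y) (hδ : 0 < δ) :
    Tendsto (poleIntegral y δ) atBot (𝓝 0) := by
  set K : ℝ := 1 / |δ| * (Real.sqrt (Real.pi / y) / 2) with hK
  have hb : ∀ Z, |poleIntegral y δ Z| ≤ Real.exp (δ * Z + δ ^ 2 * y) * K := by
    intro Z
    unfold poleIntegral
    rw [abs_mul, Real.abs_exp]
    refine mul_le_mul_of_nonneg_left ?_ (Real.exp_pos _).le
    have h1 : |∫ s in Set.Ioi (0 : ℝ), Real.exp (-(s ^ 2 * y)) * oscKernel δ (Z + 2 * δ * y) s| ≤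
        ∫ s in Set.Ioi (0 : ℝ), 1 / |δ| * Real.exp (-(s ^ 2 * y)) := by
      rw [← Real.norm_eq_abs]
      refine norm_integral_le_of_norm_le ((integrableOn_gaussian hy _).const_mul _)
        (Eventually.of_forall fun s => ?_)
      rw [Real.norm_eq_abs, abs_mul, Real.abs_exp, mul_comm]
      exact mul_le_mul_of_nonneg_right (abs_oscKernel_le_left _ _ hδ.ne') (Real.exp_pos _).le
    refine h1.trans (le_of_eq ?_)
    rw [integral_const_mul, hK]
    congr 1
    have := integral_gaussian_Ioi y
    simpa only [neg_mul, mul_comm] using this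
  refine squeeze_zero_norm hb ?_
  have : Tendsto (fun Z => Real.exp (δ * Z + δ ^ 2 * y)) atBot (𝓝 0) :=
    Real.tendsto_exp_atBot.comp
      (tendsto_atBot_add_const_right _ _ (tendsto_id.const_mul_atBot hδ))
  simpa using this.mul_const K

lemma poleIntegral_zero_of_pos {y δ : ℝ} (hy : 0 < y) (hδ : 0 < δ) :
    poleIntegral y δ 0 = Real.pi / 2 := by
  have h1 : Tendsto (erfPi y) atBot (𝓝 (-Real.pi)) := by
    have := ((tendsto_erfPi_atTop hy).comp tendsto_neg_atBot_atTop).neg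
    refine this.congr fun Z => ?_
    simp [erfPi_neg]
  have h2 : Tendsto (poleIntegral y δ) atBot (𝓝 (poleIntegral y δ 0 + -Real.pi / 2)) := by
    refine ((h1.div_const 2).const_add (poleIntegral y δ 0)).congr fun Z => ?_
    exact (poleIntegral_eq_add hy δ Z).symm
  have := tendsto_nhds_unique h2 (tendsto_poleIntegral_atBot hy hδ)
  linarith

/-- The value at Z = 0 is odd in δ. It is π/2 for δ > 0 by comparison at -∞, hence -π/2 for δ < 0,
and 0 at δ = 0, which is the principal value. -/
lemma poleIntegral_eq {y : ℝ} (hy : 0 < y) (δ Z : ℝ) :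
    poleIntegral y δ Z = (erfPi y Z + Real.pi * Real.sign δ) / 2 := by
  rw [poleIntegral_eq_add hy]
  have hneg : poleIntegral y (-δ) 0 = -poleIntegral y δ 0 := by
    simpa using poleIntegral_neg_neg y δ 0
  rcases lt_trichotomy δ 0 with h | h | h
  · rw [Real.sign_of_neg h]
    rw [poleIntegral_zero_of_pos hy (neg_pos.2 h)] at hneg
    linarith
  · subst h
    rw [neg_zero] at hneg
    rw [Real.sign_zero]
    linarith
  · rw [Real.sign_of_pos h, poleIntegral_zero_of_pos hy h]
    ring

/-! ### The cut-off line integral and its principal value -/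

lemma heaviside_of_pos {t : ℝ} (h : 0 < t) : heaviside t = 1 := by
  simp [heaviside, h.not_gt, h.ne']

lemma heaviside_of_neg {t : ℝ} (h : t < 0) : heaviside t = 0 := by
  simp [heaviside, h]

lemma heaviside_nonneg (t : ℝ) : 0 ≤ heaviside t := by
  unfold heaviside
  split_ifs <;> norm_num

lemma heaviside_le_one (t : ℝ) : heaviside t ≤ 1 := by
  unfold heaviside
  split_ifs <;> norm_num

lemma heaviside_eq_sign (t : ℝ) : heaviside t = (1 + Real.sign t) / 2 := by
  rcases lt_trichotomy t 0 with h | h | h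
  · simp [heaviside_of_neg h, Real.sign_of_neg h]
  · simp [h, heaviside]
  · rw [heaviside_of_pos h, Real.sign_of_pos h]
    norm_num

@[fun_prop]
lemma measurable_heaviside : Measurable heaviside := by
  unfold heaviside
  exact Measurable.ite measurableSet_Iio measurable_const
    (Measurable.ite (measurableSet_singleton 0) measurable_const measurable_const)

/-- The cut-off Gaussian has an integrable majorant, for either sign of `y`. -/
lemma exists_integrable_majorant {y : ℝ} (hy : y ≠ 0) (q : ℝ) :
    ∃ w : ℝ → ℝ, Integrable w ∧
      ∀ s, heaviside ((s ^ 2 - q ^ 2) * y) * Real.exp (-(s ^ 2 * y)) ≤ w s := by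
  rcases lt_or_gt_of_ne hy with hy | hy
  · refine ⟨(Set.Icc (-|q|) |q|).indicator fun _ => Real.exp (-(q ^ 2 * y)), ?_, fun s => ?_⟩
    · exact (integrable_indicator_iff measurableSet_Icc).2 (integrableOn_const (by simp))
    · by_cases hs : s ∈ Set.Icc (-|q|) |q|
      · rw [Set.indicator_of_mem hs]
        have h1 : s ^ 2 ≤ q ^ 2 := sq_le_sq.2 (abs_le.2 hs)
        calc _ ≤ 1 * Real.exp (-(s ^ 2 * y)) :=
              mul_le_mul_of_nonneg_right (heaviside_le_one _) (Real.exp_pos _).le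
          _ ≤ _ := by
              rw [one_mul]
              exact Real.exp_le_exp.2 (by nlinarith)
      · rw [Set.indicator_of_notMem hs]
        have h1 : q ^ 2 < s ^ 2 := sq_lt_sq.2 (by
          by_contra hc
          exact hs (abs_le.1 (not_lt.1 hc)))
        rw [heaviside_of_neg (mul_neg_of_pos_of_neg (by linarith) hy), zero_mul]
  · refine ⟨fun s => Real.exp (-(s ^ 2 * y)), ?_, fun s => ?_⟩
    · exact integrableOn_univ.1 (integrableOn_gaussian hy Set.univ)
    · exact mul_le_of_le_one_left (Real.exp_pos _).le (heaviside_le_one _)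

/-- A rational function with simple poles at `k₁` and `k₂` and the value `1` at infinity. -/
def twoPole (k₁ k₂ c₁ c₂ : ℝ) (μ : ℂ) : ℂ := 1 + c₁ / (μ - k₁) + c₂ / (μ - k₂)

/-- The integrand of the Green function on the line `Re μ = r`. -/
def lineIntegrand (k₁ k₂ c₁ c₂ X y r s : ℝ) : ℂ :=
  Complex.exp ((r + Complex.I * s) * X + (r + Complex.I * s) ^ 2 * y) *
    twoPole k₁ k₂ c₁ c₂ (r + Complex.I * s)

/-- The part of `lineIntegrand` that is even in `s`, without the factor `e^{r X + r² y}`. -/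
def evenDensity (k₁ k₂ c₁ c₂ X y r s : ℝ) : ℝ :=
  Real.exp (-(s ^ 2 * y)) * (Real.cos (s * (X + 2 * r * y)) +
    c₁ * oscKernel (r - k₁) (X + 2 * r * y) s + c₂ * oscKernel (r - k₂) (X + 2 * r * y) s)

lemma exp_line (X y r s : ℝ) :
    Complex.exp ((r + Complex.I * s) * X + (r + Complex.I * s) ^ 2 * y) =
      ((Real.exp (r * X + r ^ 2 * y) * Real.exp (-(s ^ 2 * y)) : ℝ) : ℂ) *
        (Real.cos (s * (X + 2 * r * y)) + Real.sin (s * (X + 2 * r * y)) * Complex.I) := by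
  rw [Complex.ofReal_cos, Complex.ofReal_sin, ← Complex.exp_mul_I]
  push_cast
  rw [← Complex.exp_add, ← Complex.exp_add]
  congr 1
  linear_combination (s : ℂ) ^ 2 * y * Complex.I_sq

lemma pole_add_pole_neg {δ s : ℝ} (hs : s ≠ 0) (A : ℝ) :
    ((Real.cos (s * A) : ℂ) + Real.sin (s * A) * Complex.I) / (δ + Complex.I * s) +
      ((Real.cos (s * A) : ℂ) - Real.sin (s * A) * Complex.I) / (δ - Complex.I * s) =
      ((2 * oscKernel δ A s : ℝ) : ℂ) := by
  have h1 : (δ : ℂ) + Complex.I * s ≠ 0 := by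
    intro h
    have := congrArg Complex.im h
    simp at this
    exact hs this
  have h2 : (δ : ℂ) - Complex.I * s ≠ 0 := by
    intro h
    have := congrArg Complex.im h
    simp at this
    exact hs this
  have h3 : ((δ : ℂ) ^ 2 + s ^ 2) = (δ + Complex.I * s) * (δ - Complex.I * s) := by
    linear_combination ((s : ℂ) ^ 2) * Complex.I_sq
  unfold oscKernel
  push_cast
  rw [h3, div_add_div _ _ h1 h2, ← mul_div_assoc]
  congr 1
  linear_combination (-2 * (s : ℂ) * Complex.sin (s * A)) * Complex.I_sq

/-- Opposite values of s give complex conjugates, so their sum is twice a real part. When r is a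
pole, the non-integrable 1/s lies in the odd part and disappears. -/
lemma lineIntegrand_add_neg (k₁ k₂ c₁ c₂ X y r : ℝ) {s : ℝ} (hs : s ≠ 0) :
    lineIntegrand k₁ k₂ c₁ c₂ X y r s + lineIntegrand k₁ k₂ c₁ c₂ X y r (-s) =
      ((2 * Real.exp (r * X + r ^ 2 * y) * evenDensity k₁ k₂ c₁ c₂ X y r s : ℝ) : ℂ) := by
  have h1 := pole_add_pole_neg (δ := r - k₁) hs (X + 2 * r * y)
  have h2 := pole_add_pole_neg (δ := r - k₂) hs (X + 2 * r * y)
  have e : ∀ k : ℝ, (r : ℂ) + Complex.I * s - k = ((r - k : ℝ) : ℂ) + Complex.I * s := by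
    intro k; push_cast; ring
  have e' : ∀ k : ℝ, (r : ℂ) + Complex.I * ((-s : ℝ) : ℂ) - k =
      ((r - k : ℝ) : ℂ) - Complex.I * s := by
    intro k; push_cast; ring
  unfold lineIntegrand twoPole evenDensity
  rw [exp_line, exp_line, e, e, e', e', neg_sq, neg_mul, Real.cos_neg, Real.sin_neg]
  push_cast at h1 h2 ⊢
  linear_combination (Complex.exp (r * X + r ^ 2 * y) * Complex.exp (-(s ^ 2 * y))) *
    (c₁ * h1 + c₂ * h2)

lemma norm_exp_line (X y r s : ℝ) :
    ‖Complex.exp ((r + Complex.I * s) * X + (r + Complex.I * s) ^ 2 * y)‖ =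
      Real.exp (r * X + r ^ 2 * y) * Real.exp (-(s ^ 2 * y)) := by
  rw [exp_line, Complex.ofReal_cos, Complex.ofReal_sin, ← Complex.exp_mul_I, norm_mul,
    Complex.norm_exp_ofReal_mul_I, mul_one, Complex.norm_real, Real.norm_eq_abs,
    abs_of_nonneg (by positivity)]

lemma norm_twoPole_le (k₁ k₂ c₁ c₂ r : ℝ) {s ε : ℝ} (hε : 0 < ε) (hs : ε ≤ |s|) :
    ‖twoPole k₁ k₂ c₁ c₂ (r + Complex.I * s)‖ ≤ 1 + |c₁| / ε + |c₂| / ε := by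
  have h : ∀ k c : ℝ, ‖(c : ℂ) / (r + Complex.I * s - k)‖ ≤ |c| / ε := by
    intro k c
    rw [norm_div, Complex.norm_real, Real.norm_eq_abs]
    refine div_le_div_of_nonneg_left (abs_nonneg c) hε (hs.trans ?_)
    have := Complex.abs_im_le_norm ((r : ℂ) + Complex.I * s - k)
    simpa using this
  unfold twoPole
  refine (norm_add_le _ _).trans (add_le_add ((norm_add_le _ _).trans (add_le_add ?_ (h _ _)))
    (h _ _))
  simp

lemma measurable_lineIntegrand (k₁ k₂ c₁ c₂ X y r : ℝ) :
    Measurable (lineIntegrand k₁ k₂ c₁ c₂ X y r) := by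
  unfold lineIntegrand twoPole
  fun_prop

lemma measurable_evenDensity (k₁ k₂ c₁ c₂ X y r : ℝ) :
    Measurable (evenDensity k₁ k₂ c₁ c₂ X y r) := by
  unfold evenDensity
  fun_prop

lemma measurableSet_lt_abs (ε : ℝ) : MeasurableSet {s : ℝ | ε < |s|} :=
  measurableSet_lt measurable_const (by fun_prop)

lemma setIntegral_lt_abs {F : ℝ → ℂ} {ε : ℝ} (hε : 0 < ε) (hF : IntegrableOn F {s | ε < |s|}) :
    ∫ s in {s | ε < |s|}, F s = ∫ s in Set.Ioi ε, (F s + F (-s)) := by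
  have hset : {s : ℝ | ε < |s|} = Set.Ioi ε ∪ Set.Iio (-ε) := by
    ext s
    simp only [Set.mem_ofPred_eq, Set.mem_union, Set.mem_Ioi, Set.mem_Iio, lt_abs]
    constructor <;> rintro (h | h)
    · exact Or.inl h
    · exact Or.inr (by linarith)
    · exact Or.inl h
    · exact Or.inr (by linarith)
  have h1 : IntegrableOn F (Set.Ioi ε) := hF.mono_set (hset ▸ Set.subset_union_left)
  have h2 : IntegrableOn F (Set.Iio (-ε)) := hF.mono_set (hset ▸ Set.subset_union_right)
  have h3 : IntegrableOn (fun s => F (-s)) (Set.Ioi ε) := by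
    simpa using h2.comp_neg
  rw [hset, setIntegral_union ?_ measurableSet_Iio h1 h2, integral_add h1 h3]
  · rw [integral_comp_neg_Ioi, integral_Iic_eq_integral_Iio]
  · rw [Set.disjoint_left]
    intro s hs hs'
    simp only [Set.mem_Ioi, Set.mem_Iio] at hs hs'
    linarith

/-- A principal value exists as soon as the even part of the integrand is integrable. -/
lemma tendsto_setIntegral_lt_abs {F Φ : ℝ → ℂ} (hF : ∀ ε > 0, IntegrableOn F {s | ε < |s|})
    (hΦ : IntegrableOn Φ (Set.Ioi 0)) (h : ∀ s > 0, F s + F (-s) = Φ s) :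
    Tendsto (fun ε => ∫ s in {s | ε < |s|}, F s) (𝓝[>] 0) (𝓝 (∫ s in Set.Ioi 0, Φ s)) := by
  have hc : AECover (volume.restrict (Set.Ioi (0 : ℝ))) (𝓝[>] (0 : ℝ)) fun ε => Set.Ioi ε :=
    aecover_Ioi_of_Ioi (tendsto_nhdsWithin_of_tendsto_nhds tendsto_id)
  have := hc.integral_tendsto_of_countably_generated hΦ
  refine this.congr' ?_
  filter_upwards [self_mem_nhdsWithin] with ε hε
  have hε' : (0 : ℝ) < ε := hε
  rw [setIntegral_lt_abs hε' (hF ε hε'), Measure.restrict_restrict measurableSet_Ioi,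
    Set.Ioi_inter_Ioi, max_eq_left hε'.le]
  exact setIntegral_congr_fun measurableSet_Ioi fun s hs => (h s (hε'.trans hs)).symm

lemma integrableOn_cut_lineIntegrand (k₁ k₂ c₁ c₂ X r q : ℝ) {y ε : ℝ} (hy : y ≠ 0)
    (hε : 0 < ε) :
    IntegrableOn (fun s : ℝ => (heaviside ((s ^ 2 - q ^ 2) * y) : ℂ) *
      lineIntegrand k₁ k₂ c₁ c₂ X y r s) {s | ε < |s|} := by
  obtain ⟨w, hw, hle⟩ := exists_integrable_majorant hy q
  refine Integrable.mono' (g := fun s => w s *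
    (Real.exp (r * X + r ^ 2 * y) * (1 + |c₁| / ε + |c₂| / ε))) (hw.integrableOn.mul_const _) ?_ ?_
  · refine Measurable.aestronglyMeasurable (Measurable.mul ?_ (measurable_lineIntegrand ..))
    fun_prop
  · refine (ae_restrict_iff' (measurableSet_lt_abs ε)).2 (Eventually.of_forall fun s hs => ?_)
    have h1 := norm_twoPole_le k₁ k₂ c₁ c₂ r hε (le_of_lt hs)
    unfold lineIntegrand
    rw [norm_mul, norm_mul, norm_exp_line, Complex.norm_real, Real.norm_eq_abs,
      abs_of_nonneg (heaviside_nonneg _)]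
    calc _ = (heaviside ((s ^ 2 - q ^ 2) * y) * Real.exp (-(s ^ 2 * y))) *
          (Real.exp (r * X + r ^ 2 * y) * ‖twoPole k₁ k₂ c₁ c₂ (r + Complex.I * s)‖) := by ring
      _ ≤ w s * (Real.exp (r * X + r ^ 2 * y) * (1 + |c₁| / ε + |c₂| / ε)) := by
        have h0 := heaviside_nonneg ((s ^ 2 - q ^ 2) * y)
        refine mul_le_mul (hle s) (mul_le_mul_of_nonneg_left h1 (by positivity)) (by positivity)
          ((by positivity : (0 : ℝ) ≤ _).trans (hle s))

lemma abs_evenFactor_le (k₁ k₂ c₁ c₂ A r : ℝ) {s : ℝ} (hs : 0 ≤ s) :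
    |Real.cos (s * A) + c₁ * oscKernel (r - k₁) A s + c₂ * oscKernel (r - k₂) A s| ≤
      1 + |c₁| * (1 / |r - k₁| + |A|) + |c₂| * (1 / |r - k₂| + |A|) := by
  refine (abs_add_le _ _).trans (add_le_add ((abs_add_le _ _).trans
    (add_le_add (Real.abs_cos_le_one _) ?_)) ?_) <;>
  · rw [abs_mul]
    exact mul_le_mul_of_nonneg_left (abs_oscKernel_le _ _ hs) (abs_nonneg _)

/-- The bound 1/|δ| + |A| on the kernel is meaningful at δ = 0 as well, with 1/0 = 0; so
integrability reaches down to s = 0 even on a line through a pole. -/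
lemma integrableOn_cut_evenDensity (k₁ k₂ c₁ c₂ X r q : ℝ) {y : ℝ} (hy : y ≠ 0) :
    IntegrableOn (fun s : ℝ => heaviside ((s ^ 2 - q ^ 2) * y) *
      evenDensity k₁ k₂ c₁ c₂ X y r s) (Set.Ioi 0) := by
  obtain ⟨w, hw, hle⟩ := exists_integrable_majorant hy q
  refine Integrable.mono' (hw.integrableOn.mul_const
    (1 + |c₁| * (1 / |r - k₁| + |X + 2 * r * y|) + |c₂| * (1 / |r - k₂| + |X + 2 * r * y|))) ?_ ?_
  · refine Measurable.aestronglyMeasurable (Measurable.mul ?_ (measurable_evenDensity ..))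
    fun_prop
  · refine (ae_restrict_iff' measurableSet_Ioi).2 (Eventually.of_forall fun s hs => ?_)
    have h0 := heaviside_nonneg ((s ^ 2 - q ^ 2) * y)
    unfold evenDensity
    rw [← mul_assoc, Real.norm_eq_abs, abs_mul, abs_mul, Real.abs_exp, abs_of_nonneg h0]
    exact mul_le_mul (hle s) (abs_evenFactor_le _ _ _ _ _ _ (le_of_lt hs)) (abs_nonneg _)
      ((by positivity : (0 : ℝ) ≤ _).trans (hle s))

/-- The integral of the even density over `s > q` if `y > 0`, and over `0 < s < q` if `y < 0`. -/
def cutIntegral (k₁ k₂ c₁ c₂ X y r q : ℝ) : ℝ :=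
  ∫ s in Set.Ioi (0 : ℝ), heaviside ((s ^ 2 - q ^ 2) * y) * evenDensity k₁ k₂ c₁ c₂ X y r s

lemma tendsto_cut_lineIntegrand (k₁ k₂ c₁ c₂ X r q : ℝ) {y : ℝ} (hy : y ≠ 0) :
    Tendsto (fun ε => ∫ s in {s : ℝ | ε < |s|}, (heaviside ((s ^ 2 - q ^ 2) * y) : ℂ) *
      lineIntegrand k₁ k₂ c₁ c₂ X y r s) (𝓝[>] 0)
      (𝓝 ((2 * Real.exp (r * X + r ^ 2 * y) * cutIntegral k₁ k₂ c₁ c₂ X y r q : ℝ) : ℂ)) := by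
  have h := tendsto_setIntegral_lt_abs
    (fun ε hε => integrableOn_cut_lineIntegrand k₁ k₂ c₁ c₂ X r q hy hε)
    (Φ := fun s => ((2 * Real.exp (r * X + r ^ 2 * y) * (heaviside ((s ^ 2 - q ^ 2) * y) *
      evenDensity k₁ k₂ c₁ c₂ X y r s) : ℝ) : ℂ))
    ((integrableOn_cut_evenDensity k₁ k₂ c₁ c₂ X r q hy).const_mul _).ofReal fun s hs => by
      rw [neg_sq, ← mul_add, lineIntegrand_add_neg _ _ _ _ _ _ _ (ne_of_gt hs)]
      push_cast
      ring
  rw [integral_complex_ofReal, integral_const_mul] at h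
  exact h

lemma cutIntegral_of_pos (k₁ k₂ c₁ c₂ X r : ℝ) {y q : ℝ} (hy : 0 < y) (hq : 0 ≤ q) :
    cutIntegral k₁ k₂ c₁ c₂ X y r q = ∫ s in Set.Ioi q, evenDensity k₁ k₂ c₁ c₂ X y r s := by
  have h1 : Set.Ioi q = Set.Ioi 0 ∩ Set.Ioi q := by
    rw [Set.Ioi_inter_Ioi, max_eq_right hq]
  rw [h1, ← setIntegral_indicator measurableSet_Ioi]
  refine setIntegral_congr_ae measurableSet_Ioi ?_
  -- The point s = q, where the Heaviside function is 1/2, is a null set.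
  filter_upwards [Measure.ae_ne volume q] with s hsq hs
  have hs0 : 0 < s := hs
  rcases lt_or_gt_of_ne hsq with h | h
  · rw [Set.indicator_of_notMem (by simpa using h.le), heaviside_of_neg, zero_mul]
    exact mul_neg_of_neg_of_pos (by nlinarith) hy
  · rw [Set.indicator_of_mem (by simpa using h), heaviside_of_pos, one_mul]
    exact mul_pos (by nlinarith) hy

lemma cutIntegral_of_neg (k₁ k₂ c₁ c₂ X r : ℝ) {y q : ℝ} (hy : y < 0) (hq : 0 ≤ q) :
    cutIntegral k₁ k₂ c₁ c₂ X y r q = ∫ s in (0 : ℝ)..q, evenDensity k₁ k₂ c₁ c₂ X y r s := by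
  have h1 : Set.Ioc 0 q = Set.Ioi 0 ∩ Set.Iic q := Set.Ioi_inter_Iic.symm
  rw [intervalIntegral.integral_of_le hq, h1, ← setIntegral_indicator measurableSet_Iic]
  refine setIntegral_congr_ae measurableSet_Ioi ?_
  filter_upwards [Measure.ae_ne volume q] with s hsq hs
  have hs0 : 0 < s := hs
  rcases lt_or_gt_of_ne hsq with h | h
  · rw [Set.indicator_of_mem (by simpa using h.le), heaviside_of_pos, one_mul]
    exact mul_pos_of_neg_of_neg (by nlinarith) hy
  · rw [Set.indicator_of_notMem (by simpa using h), heaviside_of_neg, zero_mul]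
    exact mul_neg_of_pos_of_neg (by nlinarith) hy

/-! ### The real form of 𝒢 and its dependence on the spectral parameter -/

/-- The exponential `e^{k X + k² y}`. -/
def expPhase (k X y : ℝ) : ℝ := Real.exp (k * X + k ^ 2 * y)

lemma expPhase_pos (k X y : ℝ) : 0 < expPhase k X y := Real.exp_pos _

/-- The Green function `𝒢` in terms of the residues `c₁`, `c₂` and of the differences `X`, `y` of
the coordinates, at the spectral parameter `r ± i q`. -/
def realGreen (k₁ k₂ c₁ c₂ X y r q : ℝ) : ℝ :=
  -(Real.sign y / Real.pi) * expPhase r X y * cutIntegral k₁ k₂ c₁ c₂ X y r q -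
    heaviside (-y) * (heaviside (r - k₁) * (c₁ * expPhase k₁ X y) +
      heaviside (r - k₂) * (c₂ * expPhase k₂ X y))

lemma evenDensity_swap (k₁ k₂ c₁ c₂ X y r s : ℝ) :
    evenDensity k₁ k₂ c₁ c₂ X y r s = evenDensity k₂ k₁ c₂ c₁ X y r s := by
  unfold evenDensity
  ring

lemma realGreen_swap (k₁ k₂ c₁ c₂ X y r q : ℝ) :
    realGreen k₁ k₂ c₁ c₂ X y r q = realGreen k₂ k₁ c₂ c₁ X y r q := by
  unfold realGreen cutIntegral
  simp only [evenDensity_swap k₁ k₂]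
  ring

/-- The part of `𝒢` that does not depend on the spectral parameter. -/
def background (k₁ k₂ c₁ c₂ X y : ℝ) : ℝ :=
  if 0 < y then
    -(Real.sqrt (Real.pi / y) / (2 * Real.pi) * Real.exp (-(X ^ 2 / (4 * y))) +
      (c₁ * expPhase k₁ X y * erfPi y (X + 2 * k₁ * y) +
        c₂ * expPhase k₂ X y * erfPi y (X + 2 * k₂ * y)) / (2 * Real.pi))
  else 0

lemma background_swap (k₁ k₂ c₁ c₂ X y : ℝ) :
    background k₁ k₂ c₁ c₂ X y = background k₂ k₁ c₂ c₁ X y := by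
  unfold background
  split_ifs
  · ring
  · rfl

lemma expPhase_eq_mul (k r X y : ℝ) :
    expPhase r X y = expPhase k X y *
      Real.exp ((r - k) * (X + 2 * k * y) + (r - k) ^ 2 * y) := by
  unfold expPhase
  rw [← Real.exp_add]
  congr 1
  ring

/-- The exponent is expanded about k: this is `poleIntegral` with δ = r - k and Z = X + 2ky. -/
lemma expPhase_mul_integral_oscKernel {y : ℝ} (hy : 0 < y) (k r X : ℝ) :
    expPhase r X y *
      ∫ s in Set.Ioi (0 : ℝ), Real.exp (-(s ^ 2 * y)) * oscKernel (r - k) (X + 2 * r * y) s =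
    expPhase k X y * ((erfPi y (X + 2 * k * y) + Real.pi * Real.sign (r - k)) / 2) := by
  rw [← poleIntegral_eq hy, expPhase_eq_mul k r, poleIntegral, mul_assoc]
  have : X + 2 * k * y + 2 * (r - k) * y = X + 2 * r * y := by ring
  rw [this]

lemma integrableOn_evenDensity {y q : ℝ} (hy : 0 < y) (hq : 0 ≤ q) (k₁ k₂ c₁ c₂ X r : ℝ) :
    IntegrableOn (evenDensity k₁ k₂ c₁ c₂ X y r) (Set.Ioi q) :=
  integrableOn_gaussian_mul hy (by fun_prop) hq fun _ hs => abs_evenFactor_le _ _ _ _ _ _ hs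

lemma expPhase_mul_integral_evenDensity {y : ℝ} (hy : 0 < y) (k₁ k₂ c₁ c₂ X r : ℝ) :
    expPhase r X y * ∫ s in Set.Ioi (0 : ℝ), evenDensity k₁ k₂ c₁ c₂ X y r s =
      Real.sqrt (Real.pi / y) / 2 * Real.exp (-(X ^ 2 / (4 * y))) +
        c₁ * (expPhase k₁ X y *
          ((erfPi y (X + 2 * k₁ * y) + Real.pi * Real.sign (r - k₁)) / 2)) +
        c₂ * (expPhase k₂ X y *
          ((erfPi y (X + 2 * k₂ * y) + Real.pi * Real.sign (r - k₂)) / 2)) := by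
  have hosc : ∀ k, IntegrableOn (fun s : ℝ => Real.exp (-(s ^ 2 * y)) *
      oscKernel (r - k) (X + 2 * r * y) s) (Set.Ioi 0) := fun k =>
    integrableOn_gaussian_mul hy (by fun_prop) le_rfl fun s hs => abs_oscKernel_le _ _ hs
  have hcos : IntegrableOn (fun s : ℝ => Real.exp (-(s ^ 2 * y)) *
      Real.cos (s * (X + 2 * r * y))) (Set.Ioi 0) :=
    integrableOn_gaussian_mul hy (by fun_prop) le_rfl fun s _ => Real.abs_cos_le_one _
  have hsplit : ∀ s, evenDensity k₁ k₂ c₁ c₂ X y r s =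
      Real.exp (-(s ^ 2 * y)) * Real.cos (s * (X + 2 * r * y)) +
        c₁ * (Real.exp (-(s ^ 2 * y)) * oscKernel (r - k₁) (X + 2 * r * y) s) +
        c₂ * (Real.exp (-(s ^ 2 * y)) * oscKernel (r - k₂) (X + 2 * r * y) s) := by
    intro s
    unfold evenDensity
    ring
  have hexp : expPhase r X y * Real.exp (-((X + 2 * r * y) ^ 2 / (4 * y))) =
      Real.exp (-(X ^ 2 / (4 * y))) := by
    unfold expPhase
    rw [← Real.exp_add]
    congr 1
    field_simp
    ring
  have hadd : IntegrableOn (fun s : ℝ =>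
      Real.exp (-(s ^ 2 * y)) * Real.cos (s * (X + 2 * r * y)) +
        c₁ * (Real.exp (-(s ^ 2 * y)) * oscKernel (r - k₁) (X + 2 * r * y) s)) (Set.Ioi 0) :=
    hcos.add ((hosc k₁).const_mul c₁)
  simp only [hsplit]
  rw [integral_add hadd ((hosc k₂).const_mul c₂),
    integral_add hcos ((hosc k₁).const_mul c₁), integral_const_mul, integral_const_mul,
    integral_gaussian_cos hy, ← expPhase_mul_integral_oscKernel hy k₁ r X,
    ← expPhase_mul_integral_oscKernel hy k₂ r X, ← hexp]
  ring

lemma intervalIntegrable_evenDensity (k₁ k₂ c₁ c₂ X y r : ℝ) {a b : ℝ} (ha : 0 ≤ a)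
    (hb : 0 ≤ b) : IntervalIntegrable (evenDensity k₁ k₂ c₁ c₂ X y r) volume a b := by
  unfold evenDensity
  refine IntervalIntegrable.continuousOn_mul ?_ (by fun_prop)
  exact intervalIntegrable_of_bounded (by fun_prop) ha hb
    fun s hs => abs_evenFactor_le _ _ _ _ _ _ hs

/-- The spectral parameter enters `𝒢` only through the signs of `r - k_j` and an integral over a
segment. -/
lemma realGreen_eq {y q : ℝ} (hy : y ≠ 0) (hq : 0 ≤ q) {k₁ k₂ c₁ c₂ X : ℝ} (r : ℝ)
    (hc : c₁ * expPhase k₁ X y + c₂ * expPhase k₂ X y = 0) :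
    realGreen k₁ k₂ c₁ c₂ X y r q = background k₁ k₂ c₁ c₂ X y -
      (c₁ * expPhase k₁ X y * Real.sign (r - k₁) +
        c₂ * expPhase k₂ X y * Real.sign (r - k₂)) / 2 +
      expPhase r X y / Real.pi * ∫ s in (0 : ℝ)..q, evenDensity k₁ k₂ c₁ c₂ X y r s := by
  have hpi := Real.pi_pos
  unfold realGreen background
  rcases lt_or_gt_of_ne hy with hy | hy
  · rw [if_neg hy.not_gt, cutIntegral_of_neg _ _ _ _ _ _ hy hq, Real.sign_of_neg hy,
      heaviside_of_pos (neg_pos.2 hy), heaviside_eq_sign, heaviside_eq_sign]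
    -- Each Heaviside value is (1 + sign)/2; the halves without a sign add up to a multiple of the
    -- vanishing combination `hc`.
    linear_combination (-1 / 2) * hc
  · rw [if_pos hy, cutIntegral_of_pos _ _ _ _ _ _ hy hq, Real.sign_of_pos hy,
      heaviside_of_neg (neg_neg_of_pos hy)]
    -- The integral beyond q is the explicit half-line integral minus the segment.
    have h1 := intervalIntegral.integral_Ioi_sub_Ioi
      (integrableOn_evenDensity hy le_rfl k₁ k₂ c₁ c₂ X r) hq
    have h2 := expPhase_mul_integral_evenDensity hy k₁ k₂ c₁ c₂ X r
    rw [← h1, zero_mul, sub_zero]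
    generalize Real.exp (-(X ^ 2 / (4 * y))) = g at h2 ⊢
    generalize erfPi y (X + 2 * k₁ * y) = e₁ at h2 ⊢
    generalize erfPi y (X + 2 * k₂ * y) = e₂ at h2 ⊢
    generalize Real.sqrt (Real.pi / y) = b at h2 ⊢
    field_simp
    linear_combination (-2) * h2

/-! ### The angular variable and the local form of 𝒢 at a pole -/

/-- The angle of `δ + i q` in the closed upper half plane, through the arctangent. -/
lemma arctan_sub_sign_eq_arccotAbs {δ q : ℝ} (h : δ ≠ 0 ∨ q ≠ 0) :
    Real.arctan (|q| / δ) / Real.pi - Real.sign δ / 2 = arccotAbs δ q / Real.pi - 1 / 2 := by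
  have hpi := Real.pi_pos
  have hre : ((δ : ℂ) + |q| * Complex.I).re = δ := by simp
  have him : ((δ : ℂ) + |q| * Complex.I).im = |q| := by simp
  have hkey : ∀ z : ℂ, 0 < z.re → z.arg = Real.arctan (z.im / z.re) := by
    intro z hz
    have h1 := abs_lt.1 (Complex.abs_arg_lt_pi_div_two_iff.2 (Or.inl hz))
    rw [← Complex.tan_arg, Real.arctan_tan h1.1 h1.2]
  unfold arccotAbs
  rcases lt_trichotomy δ 0 with hδ | hδ | hδ
  · have h2 : ((δ : ℂ) + |q| * Complex.I).arg = Real.pi + Real.arctan (|q| / δ) := by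
      have h3 := hkey (-(δ + |q| * Complex.I)) (by rw [Complex.neg_re, hre]; linarith)
      rw [Complex.neg_re, Complex.neg_im, hre, him, neg_div_neg_eq] at h3
      -- For q = 0 the point lies on the branch cut, where the angle is π.
      rcases (abs_nonneg q).eq_or_lt with hq | hq
      · rw [← hq]
        simp only [Complex.ofReal_zero, zero_mul, add_zero, zero_div, Real.arctan_zero]
        exact Complex.arg_ofReal_of_neg hδ
      · rw [Complex.arg_neg_eq_arg_sub_pi_of_im_pos (by rw [him]; exact hq)] at h3
        linarith
    rw [h2, Real.sign_of_neg hδ]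
    field_simp
    ring
  · subst hδ
    have hq : 0 < |q| := abs_pos.2 (by simpa using h)
    have h2 : (((0 : ℝ) : ℂ) + |q| * Complex.I).arg = Real.pi / 2 := by
      rw [Complex.ofReal_zero, zero_add, Complex.arg_real_mul _ hq, Complex.arg_I]
    rw [h2, Real.sign_zero, div_zero, Real.arctan_zero]
    field_simp
    ring
  · rw [hkey _ (by rw [hre]; exact hδ), hre, him, Real.sign_of_pos hδ]

/-- The value `𝔊` of the Green function at `k`, apart from the angular part. -/
def localConst (k k' c c' X y : ℝ) : ℝ :=
  background k k' c c' X y / expPhase k X y + c * (Real.sign (k - k') - 1) / 2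

/-- The remainder of the segment integral after the singular part at `k` has been removed. -/
def segmentRemainder (k k' c c' X y r q : ℝ) : ℝ :=
  Real.exp ((r - k) * (X + 2 * k * y) + (r - k) ^ 2 * y) *
    (∫ s in (0 : ℝ)..q, evenDensity k k' c c' X y r s) - c * Real.arctan (q / (r - k))

/-- Near k only sign(r - k) can jump; with the arctangent taken out of the segment integral it makes
the angle. The term at k' has a fixed sign, and the cancellation `hc` turns it into a multiple of c.
-/
lemma realGreen_eq_local {k k' c c' X y r q : ℝ} (hy : y ≠ 0)
    (hc : c * expPhase k X y + c' * expPhase k' X y = 0)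
    (hs : Real.sign (r - k') = Real.sign (k - k')) (h0 : r - k ≠ 0 ∨ q ≠ 0) :
    realGreen k k' c c' X y r |q| = expPhase k X y *
      (localConst k k' c c' X y + c * (arccotAbs (r - k) q / Real.pi) +
        segmentRemainder k k' c c' X y r |q| / Real.pi) := by
  rw [realGreen_eq hy (abs_nonneg q) r hc, hs, expPhase_eq_mul k r]
  unfold localConst segmentRemainder
  have h1 := arctan_sub_sign_eq_arccotAbs h0
  have hE := (expPhase_pos k X y).ne'
  have hpi := Real.pi_pos.ne'
  field_simp at h1 ⊢
  linear_combination (-Real.pi * Real.sign (k - k')) * hc +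
    (c * expPhase k X y) * h1

/-! ### Bounds uniform in the spectral parameter -/

/-- The weight `1 + 1 / √|y|`. -/
def timeWeight (y : ℝ) : ℝ := 1 + 1 / Real.sqrt |y|

lemma one_le_timeWeight (y : ℝ) : 1 ≤ timeWeight y := by
  unfold timeWeight
  have : 0 ≤ 1 / Real.sqrt |y| := by positivity
  linarith

lemma sqrt_pi_div_le {y : ℝ} (hy : 0 < y) : Real.sqrt (Real.pi / y) / 2 ≤ 1 / Real.sqrt y := by
  rw [Real.sqrt_div Real.pi_pos.le]
  have h : Real.sqrt Real.pi ≤ 2 := by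
    rw [Real.sqrt_le_left (by norm_num)]
    linarith [Real.pi_le_four]
  rw [div_div, div_le_div_iff₀ (by positivity) (by positivity)]
  nlinarith [Real.sqrt_nonneg y]

lemma integrableOn_shifted_gaussian {y : ℝ} (hy : 0 < y) (p : ℝ) (S : Set ℝ) :
    IntegrableOn (fun s : ℝ => Real.exp (-((s ^ 2 - p) * y))) S := by
  have := (integrableOn_gaussian hy S).const_mul (Real.exp (p * y))
  refine this.congr (Eventually.of_forall fun s => ?_)
  simp only [← Real.exp_add]
  congr 1
  ring

/-- For s ≥ q ≥ 0 one has s² - q² ≥ (s - q)², which reduces to a half Gaussian independent of q. -/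
lemma integral_shifted_gaussian_le {y q : ℝ} (hy : 0 < y) (hq : 0 ≤ q) :
    ∫ s in Set.Ioi q, Real.exp (-((s ^ 2 - q ^ 2) * y)) ≤ 1 / Real.sqrt y := by
  have hint : IntegrableOn (fun s : ℝ => Real.exp (-((s - q) ^ 2 * y))) (Set.Ioi q) := by
    refine Integrable.integrableOn ?_
    exact (integrableOn_univ.1 (integrableOn_gaussian hy Set.univ)).comp_sub_right q
  have h1 : ∫ s in Set.Ioi q, Real.exp (-((s ^ 2 - q ^ 2) * y)) ≤
      ∫ s in Set.Ioi q, Real.exp (-((s - q) ^ 2 * y)) := by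
    refine setIntegral_mono_on (integrableOn_shifted_gaussian hy _ _) hint measurableSet_Ioi ?_
    intro s hs
    have hs' : q < s := hs
    refine Real.exp_le_exp.2 (neg_le_neg (mul_le_mul_of_nonneg_right ?_ hy.le))
    nlinarith
  refine h1.trans ?_
  have h2 : ∫ s in Set.Ioi q, Real.exp (-((s - q) ^ 2 * y)) =
      ∫ s in Set.Ioi (0 : ℝ), Real.exp (-(s ^ 2 * y)) := by
    have := (measurePreserving_sub_right volume q).setIntegral_preimage_emb
      (measurableEmbedding_subRight q) (fun s : ℝ => Real.exp (-(s ^ 2 * y))) (Set.Ioi 0)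
    rw [← this]
    congr 2
    ext s
    simp
  rw [h2]
  have h3 := integral_gaussian_Ioi y
  have h4 : ∀ s : ℝ, -y * s ^ 2 = -(s ^ 2 * y) := fun s => by ring
  simp only [h4] at h3
  rw [h3]
  exact sqrt_pi_div_le hy

lemma abs_regular_part_le {c' δ' D : ℝ} (A s : ℝ) (hD : 0 < D) (hc' : |c'| ≤ D)
    (hδ' : D / 2 ≤ |δ'|) : |Real.cos (s * A) + c' * oscKernel δ' A s| ≤ 3 := by
  have h0 : δ' ≠ 0 := abs_pos.1 (lt_of_lt_of_le (by positivity) hδ')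
  have h1 : |c' * oscKernel δ' A s| ≤ 2 := by
    rw [abs_mul]
    calc _ ≤ D * (1 / (D / 2)) := by
          refine mul_le_mul hc' ((abs_oscKernel_le_left A s h0).trans ?_) (abs_nonneg _) hD.le
          exact div_le_div_of_nonneg_left zero_le_one (by positivity) hδ'
      _ = 2 := by field_simp
  exact (abs_add_le _ _).trans (by linarith [Real.abs_cos_le_one (s * A)])

/-- The factor e^{-q²y} is split off because the exponential that turns 𝒢 into G compensates exactly
this growth. The rest has a Gaussian weight at most 1 on the range of integration, for either sign
of y. -/
lemma evenDensity_eq_shifted (k k' c c' X y r q s : ℝ) :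
    evenDensity k k' c c' X y r s = Real.exp (-(q ^ 2 * y)) *
      (c * (Real.exp (-((s ^ 2 - q ^ 2) * y)) * oscKernel (r - k) (X + 2 * r * y) s) +
        Real.exp (-((s ^ 2 - q ^ 2) * y)) * (Real.cos (s * (X + 2 * r * y)) +
          c' * oscKernel (r - k') (X + 2 * r * y) s)) := by
  have : Real.exp (-(s ^ 2 * y)) = Real.exp (-(q ^ 2 * y)) * Real.exp (-((s ^ 2 - q ^ 2) * y)) := by
    rw [← Real.exp_add]
    congr 1
    ring
  unfold evenDensity
  rw [this]
  ring

/-- On [q, q + 1] the singular kernel is handled by the uniform bound 16; beyond q + 1 it is at most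
1/s ≤ 1, and the Gaussian tail is at most 1/√y. The part regular at k is at most 3 times the
Gaussian. -/
lemma abs_cutIntegral_le_of_pos {k k' c c' X y r q D : ℝ} (hD : 0 < D) (hc : |c| ≤ D)
    (hc' : |c'| ≤ D) (hr : D / 2 ≤ |r - k'|) (hq : 0 ≤ q) (hy : 0 < y) :
    |cutIntegral k k' c c' X y r q| ≤
      Real.exp (-(q ^ 2 * y)) * ((18 * D + 3) * timeWeight y) := by
  rw [cutIntegral_of_pos _ _ _ _ _ _ hy hq]
  simp only [evenDensity_eq_shifted k k' c c' X y r q]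
  rw [integral_const_mul, abs_mul, Real.abs_exp]
  refine mul_le_mul_of_nonneg_left ?_ (Real.exp_pos _).le
  set A := X + 2 * r * y
  set h : ℝ → ℝ := fun s => Real.exp (-((s ^ 2 - q ^ 2) * y)) with hh
  set J := ∫ s in Set.Ioi q, h s with hJ
  have hhint : IntegrableOn h (Set.Ioi q) := integrableOn_shifted_gaussian hy _ _
  have hJle : J ≤ 1 / Real.sqrt |y| := by
    rw [abs_of_pos hy]
    exact integral_shifted_gaussian_le hy hq
  have hosc : IntegrableOn (fun s => h s * oscKernel (r - k) A s) (Set.Ioi q) := by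
    simp only [mul_comm (h _)]
    refine Integrable.bdd_mul (c := 1 / |r - k| + |A|) hhint
      (measurable_oscKernel _ _).aestronglyMeasurable ?_
    exact (ae_restrict_iff' measurableSet_Ioi).2 (Eventually.of_forall fun s hs =>
      abs_oscKernel_le _ _ (hq.trans (le_of_lt hs)))
  have hreg : IntegrableOn (fun s => h s * (Real.cos (s * A) + c' * oscKernel (r - k') A s))
      (Set.Ioi q) := by
    simp only [mul_comm (h _)]
    refine Integrable.bdd_mul (c := 3) hhint (Measurable.aestronglyMeasurable (by fun_prop))
      (Eventually.of_forall fun s => abs_regular_part_le A s hD hc' hr)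
  have hregb : |∫ s in Set.Ioi q, h s * (Real.cos (s * A) + c' * oscKernel (r - k') A s)| ≤
      J * 3 := by
    rw [hJ, ← integral_mul_const, ← Real.norm_eq_abs]
    refine norm_integral_le_of_norm_le (hhint.mul_const 3) (Eventually.of_forall fun s => ?_)
    rw [Real.norm_eq_abs, abs_mul, Real.abs_exp]
    exact mul_le_mul_of_nonneg_left (abs_regular_part_le A s hD hc' hr) (Real.exp_pos _).le
  have htail : |∫ s in Set.Ioi (q + 1), h s * oscKernel (r - k) A s| ≤ J := by
    have h1 : |∫ s in Set.Ioi (q + 1), h s * oscKernel (r - k) A s| ≤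
        ∫ s in Set.Ioi (q + 1), h s := by
      rw [← Real.norm_eq_abs]
      refine norm_integral_le_of_norm_le (integrableOn_shifted_gaussian hy _ _)
        ((ae_restrict_iff' measurableSet_Ioi).2 (Eventually.of_forall fun s hs => ?_))
      have hs' : q + 1 < s := hs
      rw [Real.norm_eq_abs, abs_mul, Real.abs_exp]
      refine mul_le_of_le_one_right (Real.exp_pos _).le
        ((abs_oscKernel_le_right _ _ (by linarith)).trans ?_)
      rw [div_le_one (by linarith)]
      linarith
    refine h1.trans (setIntegral_mono_set hhint
      (Eventually.of_forall fun s => (Real.exp_pos _).le) ?_)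
    exact (Set.Ioi_subset_Ioi (by linarith)).eventuallyLE
  have hnear : |∫ s in q..(q + 1), h s * oscKernel (r - k) A s| ≤ 16 := by
    refine abs_integral_gaussian_mul_oscKernel_le _ _ _ _ hq (by linarith) fun s hs => ?_
    exact mul_nonneg (by nlinarith [hs.1]) hy.le
  have hoscb : |∫ s in Set.Ioi q, h s * oscKernel (r - k) A s| ≤ 16 + J := by
    have := intervalIntegral.integral_Ioi_sub_Ioi hosc (by linarith : q ≤ q + 1)
    rw [sub_eq_iff_eq_add] at this
    rw [this]
    exact (abs_add_le _ _).trans (add_le_add hnear htail)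
  rw [integral_add (hosc.const_mul c) hreg, integral_const_mul]
  refine (abs_add_le _ _).trans ?_
  rw [abs_mul]
  have hJ0 : 0 ≤ J := integral_nonneg fun s => (Real.exp_pos _).le
  have h5 : |c| * |∫ s in Set.Ioi q, h s * oscKernel (r - k) A s| ≤ D * (16 + J) :=
    mul_le_mul hc hoscb (abs_nonneg _) hD.le
  unfold timeWeight
  nlinarith [mul_le_mul_of_nonneg_left hJle hD.le, hJ0.trans hJle,
    mul_nonneg hD.le (hJ0.trans hJle)]

/-- Only the segment [0, q] remains: the singular kernel contributes 16D, the regular part 3q ≤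
3D/2. -/
lemma abs_cutIntegral_le_of_neg {k k' c c' X y r q D : ℝ} (hD : 0 < D) (hc : |c| ≤ D)
    (hc' : |c'| ≤ D) (hr : D / 2 ≤ |r - k'|) (hq : 0 ≤ q) (hqD : q ≤ D / 2) (hy : y < 0) :
    |cutIntegral k k' c c' X y r q| ≤
      Real.exp (-(q ^ 2 * y)) * ((18 * D + 3) * timeWeight y) := by
  rw [cutIntegral_of_neg _ _ _ _ _ _ hy hq]
  simp only [evenDensity_eq_shifted k k' c c' X y r q]
  rw [intervalIntegral.integral_const_mul, abs_mul, Real.abs_exp]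
  refine mul_le_mul_of_nonneg_left ?_ (Real.exp_pos _).le
  set A := X + 2 * r * y
  have hosc : IntervalIntegrable (fun s => Real.exp (-((s ^ 2 - q ^ 2) * y)) *
      oscKernel (r - k) A s) volume 0 q :=
    (intervalIntegrable_oscKernel _ _ le_rfl hq).continuousOn_mul (by fun_prop)
  have hreg : IntervalIntegrable (fun s => Real.exp (-((s ^ 2 - q ^ 2) * y)) *
      (Real.cos (s * A) + c' * oscKernel (r - k') A s)) volume 0 q :=
    (intervalIntegrable_of_bounded (by fun_prop) le_rfl hq
      fun s _ => abs_regular_part_le A s hD hc' hr).continuousOn_mul (by fun_prop)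
  have hsgn : ∀ s ∈ Set.Icc 0 q, 0 ≤ (s ^ 2 - q ^ 2) * y := fun s hs =>
    mul_nonneg_of_nonpos_of_nonpos (by nlinarith [hs.1, hs.2]) hy.le
  have hoscb := abs_integral_gaussian_mul_oscKernel_le (r - k) A y (q ^ 2) le_rfl hq hsgn
  have hregb : |∫ s in (0 : ℝ)..q, Real.exp (-((s ^ 2 - q ^ 2) * y)) *
      (Real.cos (s * A) + c' * oscKernel (r - k') A s)| ≤ 3 * |q - 0| := by
    rw [← Real.norm_eq_abs]
    refine intervalIntegral.norm_integral_le_of_norm_le_const fun s hs => ?_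
    rw [Set.uIoc_of_le hq] at hs
    rw [Real.norm_eq_abs, abs_mul, Real.abs_exp]
    calc _ ≤ (1 : ℝ) * 3 := by
          refine mul_le_mul ?_ (abs_regular_part_le A s hD hc' hr) (abs_nonneg _) zero_le_one
          exact Real.exp_le_one_iff.2 (neg_nonpos.2 (hsgn s ⟨hs.1.le, hs.2⟩))
      _ = 3 := one_mul 3
  rw [intervalIntegral.integral_add (hosc.const_mul c) hreg, intervalIntegral.integral_const_mul]
  refine (abs_add_le _ _).trans ?_
  rw [sub_zero, abs_of_nonneg hq] at hregb
  have h5 : |c * ∫ s in (0 : ℝ)..q, Real.exp (-((s ^ 2 - q ^ 2) * y)) * oscKernel (r - k) A s| ≤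
      D * 16 := by
    rw [abs_mul]
    exact mul_le_mul hc hoscb (abs_nonneg _) hD.le
  nlinarith [one_le_timeWeight y]

/-- For `y < 0` the discrete part is controlled by the convexity of the exponent in `k`. -/
lemma abs_discrete_le {k₁ k₂ c₁ c₂ X y r q D : ℝ} (hk : k₁ < k₂) (hc₁ : |c₁| ≤ D)
    (hc₂ : |c₂| ≤ D) (hc : c₁ * expPhase k₁ X y + c₂ * expPhase k₂ X y = 0) (hy : y < 0) :
    |heaviside (r - k₁) * (c₁ * expPhase k₁ X y) +
      heaviside (r - k₂) * (c₂ * expPhase k₂ X y)| ≤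
      D * (expPhase r X y * Real.exp (-(q ^ 2 * y))) := by
  have hD : 0 ≤ D := (abs_nonneg _).trans hc₁
  have e1 : c₂ * expPhase k₂ X y = -(c₁ * expPhase k₁ X y) := by linarith
  have e2 : heaviside (r - k₁) * (c₁ * expPhase k₁ X y) +
      heaviside (r - k₂) * (c₂ * expPhase k₂ X y) =
      (heaviside (r - k₁) - heaviside (r - k₂)) * (c₁ * expPhase k₁ X y) := by
    rw [e1]
    ring
  have hrhs : 0 ≤ D * (expPhase r X y * Real.exp (-(q ^ 2 * y))) :=
    mul_nonneg hD (mul_nonneg (expPhase_pos _ _ _).le (Real.exp_pos _).le)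
  rw [e2]
  rcases lt_or_ge r k₁ with h1 | h1
  · rw [heaviside_of_neg (by linarith), heaviside_of_neg (by linarith)]
    simpa using hrhs
  rcases lt_or_ge k₂ r with h2 | h2
  · rw [heaviside_of_pos (by linarith), heaviside_of_pos (by linarith)]
    simpa using hrhs
  rw [abs_mul]
  have h3 : |heaviside (r - k₁) - heaviside (r - k₂)| ≤ 1 := by
    rw [abs_le]
    constructor <;> linarith [heaviside_nonneg (r - k₁), heaviside_nonneg (r - k₂),
      heaviside_le_one (r - k₁), heaviside_le_one (r - k₂)]
  refine (mul_le_of_le_one_left (abs_nonneg _) h3).trans ?_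
  have hexp : expPhase r X y * Real.exp (-(q ^ 2 * y)) =
      Real.exp (r * X + r ^ 2 * y - q ^ 2 * y) := by
    unfold expPhase
    rw [← Real.exp_add, sub_eq_add_neg]
  rw [hexp]
  -- For y < 0 the exponent kX + k²y is concave in k, so at r in [k₁, k₂] it is not below both end
  -- values; -q²y ≥ 0 only helps. The residue relation lets either endpoint serve for the estimate.
  have hor : k₁ * X + k₁ ^ 2 * y ≤ r * X + r ^ 2 * y - q ^ 2 * y ∨
      k₂ * X + k₂ ^ 2 * y ≤ r * X + r ^ 2 * y - q ^ 2 * y := by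
    by_contra hcon
    push Not at hcon
    have hq : 0 ≤ -(q ^ 2 * y) := by nlinarith [sq_nonneg q]
    have a1 : r * X + r ^ 2 * y < k₁ * X + k₁ ^ 2 * y := by linarith [hcon.1]
    have a2 : r * X + r ^ 2 * y < k₂ * X + k₂ ^ 2 * y := by linarith [hcon.2]
    have b1 : (k₂ - r) * (r * X + r ^ 2 * y) ≤ (k₂ - r) * (k₁ * X + k₁ ^ 2 * y) :=
      mul_le_mul_of_nonneg_left a1.le (by linarith)
    have b2 : (r - k₁) * (r * X + r ^ 2 * y) ≤ (r - k₁) * (k₂ * X + k₂ ^ 2 * y) :=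
      mul_le_mul_of_nonneg_left a2.le (by linarith)
    have b3 : 0 ≤ (k₂ - k₁) * ((k₂ - r) * (r - k₁)) * y := by nlinarith
    have b4 : (k₂ - k₁) * ((k₂ - r) * (r - k₁)) = 0 := by
      have : 0 ≤ (k₂ - k₁) * ((k₂ - r) * (r - k₁)) :=
        mul_nonneg (by linarith) (mul_nonneg (by linarith) (by linarith))
      nlinarith
    rcases mul_eq_zero.1 b4 with h | h
    · linarith
    rcases mul_eq_zero.1 h with h | h
    · have : r = k₂ := by linarith
      subst this
      linarith
    · have : r = k₁ := by linarith
      subst this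
      linarith
  rcases hor with h | h
  · rw [abs_mul, abs_of_pos (expPhase_pos _ _ _)]
    exact mul_le_mul hc₁ (Real.exp_le_exp.2 h) (expPhase_pos _ _ _).le hD
  · have : |c₁ * expPhase k₁ X y| = |c₂ * expPhase k₂ X y| := by rw [e1, abs_neg]
    rw [this, abs_mul, abs_of_pos (expPhase_pos _ _ _)]
    exact mul_le_mul hc₂ (Real.exp_le_exp.2 h) (expPhase_pos _ _ _).le hD

lemma abs_realGreen_le {k k' c c' X y r q D : ℝ} (hk : k ≠ k') (hD : 0 < D) (hc : |c| ≤ D)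
    (hc' : |c'| ≤ D) (hcc : c * expPhase k X y + c' * expPhase k' X y = 0)
    (hr : D / 2 ≤ |r - k'|) (hq : 0 ≤ q) (hqD : q ≤ D / 2) (hy : y ≠ 0) :
    |realGreen k k' c c' X y r q| ≤
      (19 * D + 3) * timeWeight y * (expPhase r X y * Real.exp (-(q ^ 2 * y))) := by
  have hw := one_le_timeWeight y
  have hP : 0 < expPhase r X y * Real.exp (-(q ^ 2 * y)) :=
    mul_pos (expPhase_pos _ _ _) (Real.exp_pos _)
  have hcut : |cutIntegral k k' c c' X y r q| ≤
      Real.exp (-(q ^ 2 * y)) * ((18 * D + 3) * timeWeight y) := by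
    rcases lt_or_gt_of_ne hy with h | h
    · exact abs_cutIntegral_le_of_neg hD hc hc' hr hq hqD h
    · exact abs_cutIntegral_le_of_pos hD hc hc' hr hq h
  have hdisc : |heaviside (-y) * (heaviside (r - k) * (c * expPhase k X y) +
      heaviside (r - k') * (c' * expPhase k' X y))| ≤
      D * (expPhase r X y * Real.exp (-(q ^ 2 * y))) := by
    rcases lt_or_gt_of_ne hy with h | h
    · rw [heaviside_of_pos (neg_pos.2 h), one_mul]
      rcases lt_or_gt_of_ne hk with h' | h'
      · exact abs_discrete_le h' hc hc' hcc h
      · rw [add_comm]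
        exact abs_discrete_le h' hc' hc (by rw [add_comm]; exact hcc) h
    · rw [heaviside_of_neg (neg_neg_of_pos h), zero_mul, abs_zero]
      exact mul_nonneg hD.le hP.le
  have hsign : |-(Real.sign y / Real.pi)| ≤ 1 := by
    rw [abs_neg, abs_div, abs_of_pos Real.pi_pos, div_le_one Real.pi_pos]
    have : |Real.sign y| ≤ 1 := by
      rcases Real.sign_apply_eq y with h | h | h <;> simp [h]
    linarith [Real.pi_gt_three]
  have hcont : |-(Real.sign y / Real.pi) * expPhase r X y * cutIntegral k k' c c' X y r q| ≤
      1 * expPhase r X y * (Real.exp (-(q ^ 2 * y)) * ((18 * D + 3) * timeWeight y)) := by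
    rw [abs_mul, abs_mul, abs_of_pos (expPhase_pos r X y)]
    exact mul_le_mul (mul_le_mul_of_nonneg_right hsign (expPhase_pos _ _ _).le) hcut
      (abs_nonneg _) (by rw [one_mul]; exact (expPhase_pos _ _ _).le)
  unfold realGreen
  refine (abs_sub _ _).trans ((add_le_add hcont hdisc).trans ?_)
  nlinarith [mul_le_mul_of_nonneg_right hw (mul_nonneg hD.le hP.le)]

lemma abs_localConst_le {k k' c c' X y D : ℝ} (hc : |c| ≤ D)
    (hcc : c * expPhase k X y + c' * expPhase k' X y = 0) :
    |localConst k k' c c' X y| ≤ (1 + 2 * D) * timeWeight y := by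
  have hw := one_le_timeWeight y
  have hD : 0 ≤ D := (abs_nonneg _).trans hc
  have hE := expPhase_pos k X y
  have h1 : |c * (Real.sign (k - k') - 1) / 2| ≤ D := by
    rw [abs_div, abs_mul, abs_two]
    have : |Real.sign (k - k') - 1| ≤ 2 := by
      rcases Real.sign_apply_eq (k - k') with h | h | h <;> rw [h] <;> norm_num
    have := mul_le_mul hc this (abs_nonneg _) hD
    linarith
  have h2 : |background k k' c c' X y / expPhase k X y| ≤ 1 / Real.sqrt |y| + D := by
    unfold background
    split_ifs with hy
    -- The cancellation leaves a difference of two error functions, each at most π, so this term is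
    -- at most |c|.
    · have e : -(Real.sqrt (Real.pi / y) / (2 * Real.pi) * Real.exp (-(X ^ 2 / (4 * y))) +
          (c * expPhase k X y * erfPi y (X + 2 * k * y) +
            c' * expPhase k' X y * erfPi y (X + 2 * k' * y)) / (2 * Real.pi)) / expPhase k X y =
          -(Real.sqrt (Real.pi / y) / 2 / Real.pi *
            (Real.exp (-(X ^ 2 / (4 * y))) / expPhase k X y)) -
          c * ((erfPi y (X + 2 * k * y) - erfPi y (X + 2 * k' * y)) / (2 * Real.pi)) := by
        have : c' * expPhase k' X y = -(c * expPhase k X y) := by linarith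
        rw [this]
        field_simp
        ring
      rw [e]
      refine (abs_sub _ _).trans (add_le_add ?_ ?_)
      · rw [abs_neg, abs_of_nonneg (mul_nonneg (by positivity) (by positivity)), abs_of_pos hy]
        -- The quotient is the exponential of -(X + 2ky)²/(4y).
        have h3 : Real.exp (-(X ^ 2 / (4 * y))) / expPhase k X y ≤ 1 := by
          rw [div_le_one hE]
          refine Real.exp_le_exp.2 ?_
          have : 0 ≤ (X + 2 * k * y) ^ 2 / (4 * y) := by positivity
          have e : (X + 2 * k * y) ^ 2 / (4 * y) = X ^ 2 / (4 * y) + (k * X + k ^ 2 * y) := by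
            field_simp
            ring
          linarith
        have h4 : Real.sqrt (Real.pi / y) / 2 / Real.pi ≤ 1 / Real.sqrt y := by
          refine (div_le_self (by positivity) ?_).trans (sqrt_pi_div_le hy)
          linarith [Real.pi_gt_three]
        exact (mul_le_of_le_one_right (by positivity) h3).trans h4
      · rw [abs_mul]
        refine (mul_le_of_le_one_right (abs_nonneg c) ?_).trans hc
        rw [abs_div, abs_of_pos (by positivity : 0 < 2 * Real.pi),
          div_le_one (by positivity)]
        refine (abs_sub _ _).trans ?_
        linarith [abs_erfPi_le hy (X + 2 * k * y), abs_erfPi_le hy (X + 2 * k' * y)]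
    · rw [zero_div, abs_zero]
      positivity
  unfold localConst
  refine (abs_add_le _ _).trans ((add_le_add h2 h1).trans ?_)
  unfold timeWeight at hw ⊢
  nlinarith

/-! ### The remainder at small scale -/

lemma abs_cos_sub_one_le (x : ℝ) : |Real.cos x - 1| ≤ |x| := by
  have h1 := Real.one_sub_sq_div_two_le_cos (x := x)
  have h2 := Real.cos_le_one x
  have h3 := Real.neg_one_le_cos x
  rw [abs_of_nonpos (by linarith)]
  rcases le_total |x| 2 with h | h
  · nlinarith [sq_abs x, abs_nonneg x]
  · linarith

/-- The kernel differs from its value at A = 0 by an amount linear in A, with no loss as δ or s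
tends to 0: |δ|s ≤ δ² + s². -/
lemma abs_oscKernel_sub_le (δ A : ℝ) {s : ℝ} (hs : 0 < s) :
    |oscKernel δ A s - δ / (δ ^ 2 + s ^ 2)| ≤ 2 * |A| := by
  have hpos : 0 < δ ^ 2 + s ^ 2 := by positivity
  have e : oscKernel δ A s - δ / (δ ^ 2 + s ^ 2) =
      (δ * (Real.cos (s * A) - 1)) / (δ ^ 2 + s ^ 2) +
        Real.sin (s * A) * (s / (δ ^ 2 + s ^ 2)) := by
    unfold oscKernel
    ring
  rw [e]
  refine (abs_add_le _ _).trans ?_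
  have h2 : |(δ * (Real.cos (s * A) - 1)) / (δ ^ 2 + s ^ 2)| ≤ |A| := by
    rw [abs_div, abs_of_pos hpos, div_le_iff₀ hpos, abs_mul]
    have h1 := abs_cos_sub_one_le (s * A)
    rw [abs_mul, abs_of_pos hs] at h1
    have h3 := mul_le_mul_of_nonneg_left h1 (abs_nonneg δ)
    have h4 : |δ| * s ≤ δ ^ 2 + s ^ 2 := by nlinarith [sq_nonneg (|δ| - s), sq_abs δ]
    nlinarith [mul_le_mul_of_nonneg_left h4 (abs_nonneg A)]
  linarith [abs_sin_part_le δ A hs.le]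

/-- Close to `k`, at the scale `1 / (1 + |X| + |y|)`, the remainder of the segment integral is
small. -/
lemma abs_segmentRemainder_le {k k' c c' X y r q D W K : ℝ} (hD : 0 < D) (hc : |c| ≤ D)
    (hc' : |c'| ≤ D) (hr : D / 2 ≤ |r - k'|) (hq : 0 ≤ q) (hqW : q ≤ W) (hδW : |r - k| ≤ W)
    (hWD : W ≤ D) (hK : K = 1 + 2 * |k| + 2 * D) (hsmall : 2 * K * (W * (1 + (|X| + |y|))) ≤ 1) :
    |segmentRemainder k k' c c' X y r q| ≤ (9 + 10 * D * K) * (W * (1 + (|X| + |y|))) := by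
  set d := |X| + |y| with hd
  set δ := r - k with hδ
  set Z := X + 2 * k * y with hZ
  set A := X + 2 * r * y with hA
  have hX : |X| ≤ d := by linarith [abs_nonneg y]
  have hY : |y| ≤ d := by linarith [abs_nonneg X]
  have hd0 : 0 ≤ d := (abs_nonneg _).trans hX
  have hK1 : 1 ≤ K := by linarith [abs_nonneg k]
  have hAd : |A| ≤ K * d := by
    have e : A = X + 2 * (k * y) + 2 * (δ * y) := by rw [hA, hδ]; ring
    have h1 : |A| ≤ |X| + 2 * (|k| * |y|) + 2 * (|δ| * |y|) := by
      rw [e]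
      refine (abs_add_le _ _).trans (add_le_add ((abs_add_le _ _).trans (add_le_add le_rfl ?_)) ?_)
      · rw [abs_mul, abs_mul, abs_two]
      · rw [abs_mul, abs_mul, abs_two]
    have h2 := mul_le_mul_of_nonneg_left hY (abs_nonneg k)
    have h3 := mul_le_mul (hδW.trans hWD) hY (abs_nonneg y) hD.le
    rw [hK]
    nlinarith
  -- The arctangent is itself a segment integral, so the remainder is the integral of a difference
  -- that is bounded pointwise.
  have hEint : segmentRemainder k k' c c' X y r q = ∫ s in (0 : ℝ)..q,
      (Real.exp (δ * Z + δ ^ 2 * y) * evenDensity k k' c c' X y r s -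
        c * (δ / (δ ^ 2 + s ^ 2))) := by
    rw [intervalIntegral.integral_sub
      ((intervalIntegrable_evenDensity k k' c c' X y r le_rfl hq).const_mul _)
      ((intervalIntegrable_cauchy δ le_rfl hq).const_mul c),
      intervalIntegral.integral_const_mul, intervalIntegral.integral_const_mul, integral_cauchy]
    simp [segmentRemainder, hδ, hZ]
  have hpt : ∀ s ∈ Set.uIoc 0 q, ‖Real.exp (δ * Z + δ ^ 2 * y) *
      evenDensity k k' c c' X y r s - c * (δ / (δ ^ 2 + s ^ 2))‖ ≤
      (9 + 10 * D * K) * (1 + d) := by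
    intro s hs
    rw [Set.uIoc_of_le hq] at hs
    have hs0 : 0 < s := hs.1
    have hsW : s ≤ W := hs.2.trans hqW
    have hpos : 0 < δ ^ 2 + s ^ 2 := by positivity
    -- The complete real exponent at s, Gaussian included. It is O((|δ| + s)(|X| + |y|)), and the
    -- smallness assumption makes it at most 1.
    set t := δ * Z + δ ^ 2 * y - s ^ 2 * y with ht
    have htb : |t| ≤ (|δ| + s) * (K * d) := by
      have e : t = δ * X + 2 * (δ * (k * y)) + δ * (δ * y) + -(s * (s * y)) := by
        rw [ht, hZ]; ring
      have h1 : |t| ≤ |δ| * |X| + 2 * (|δ| * (|k| * |y|)) + |δ| * (|δ| * |y|) +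
          s * (s * |y|) := by
        rw [e]
        refine (abs_add_le _ _).trans (add_le_add ((abs_add_le _ _).trans
          (add_le_add ((abs_add_le _ _).trans (add_le_add ?_ ?_)) ?_)) ?_)
        · rw [abs_mul]
        · rw [abs_mul, abs_mul, abs_mul, abs_two]
        · rw [abs_mul, abs_mul]
        · rw [abs_neg, abs_mul, abs_mul, abs_of_pos hs0]
      have a1 := mul_le_mul_of_nonneg_left hX (abs_nonneg δ)
      have a2 := mul_le_mul_of_nonneg_left (mul_le_mul_of_nonneg_left hY (abs_nonneg k))
        (abs_nonneg δ)
      have a3 := mul_le_mul_of_nonneg_left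
        (mul_le_mul (hδW.trans hWD) hY (abs_nonneg y) hD.le) (abs_nonneg δ)
      have a4 := mul_le_mul_of_nonneg_left
        (mul_le_mul (hsW.trans hWD) hY (abs_nonneg y) hD.le) hs0.le
      have e2 : (|δ| + s) * (K * d) = |δ| * d + 2 * (|δ| * (|k| * d)) + |δ| * (D * d) +
          s * (D * d) + (|δ| * (D * d) + s * d * (1 + 2 * |k| + D)) := by
        rw [hK]; ring
      have a5 : 0 ≤ |δ| * (D * d) + s * d * (1 + 2 * |k| + D) := by positivity
      linarith
    have ht1 : |t| ≤ 1 := by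
      have : (|δ| + s) * (K * d) ≤ (2 * W) * (K * (1 + d)) :=
        mul_le_mul (by linarith) (mul_le_mul_of_nonneg_left (by linarith) (by linarith))
          (mul_nonneg (by linarith) hd0) (by linarith)
      nlinarith
    have hexp1 := Real.abs_exp_sub_one_le ht1
    have hexp3 : Real.exp t ≤ 3 := by
      have := (abs_le.1 hexp1).2
      linarith
    have e1 : Real.exp (δ * Z + δ ^ 2 * y) * evenDensity k k' c c' X y r s -
        c * (δ / (δ ^ 2 + s ^ 2)) =
        Real.exp t * (Real.cos (s * A) + c' * oscKernel (r - k') A s) +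
          c * (Real.exp t * (oscKernel δ A s - δ / (δ ^ 2 + s ^ 2)) +
            (Real.exp t - 1) * (δ / (δ ^ 2 + s ^ 2))) := by
      have : Real.exp t = Real.exp (δ * Z + δ ^ 2 * y) * Real.exp (-(s ^ 2 * y)) := by
        rw [← Real.exp_add, ht, sub_eq_add_neg]
      unfold evenDensity
      rw [this]
      ring
    have b1 : |Real.exp t * (Real.cos (s * A) + c' * oscKernel (r - k') A s)| ≤ 3 * 3 := by
      rw [abs_mul, Real.abs_exp]
      exact mul_le_mul hexp3 (abs_regular_part_le A s hD hc' hr) (abs_nonneg _) (by norm_num)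
    have b2 : |Real.exp t * (oscKernel δ A s - δ / (δ ^ 2 + s ^ 2))| ≤ 3 * (2 * (K * d)) := by
      rw [abs_mul, Real.abs_exp]
      exact mul_le_mul hexp3 ((abs_oscKernel_sub_le δ A hs0).trans (by linarith)) (abs_nonneg _)
        (by norm_num)
    -- Here |e^t - 1| ≤ 2|t| carries a factor |δ| + s, which cancels the singularity of the Cauchy
    -- density.
    have b3 : |(Real.exp t - 1) * (δ / (δ ^ 2 + s ^ 2))| ≤ 4 * (K * d) := by
      rw [abs_mul, abs_div, abs_of_pos hpos, ← mul_div_assoc, div_le_iff₀ hpos]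
      have h1 : |Real.exp t - 1| * |δ| ≤ 2 * ((|δ| + s) * (K * d)) * |δ| :=
        mul_le_mul_of_nonneg_right (hexp1.trans (by linarith)) (abs_nonneg δ)
      have h2 : (|δ| + s) * |δ| ≤ 2 * (δ ^ 2 + s ^ 2) := by
        nlinarith [sq_nonneg (|δ| - s), sq_abs δ, sq_nonneg s]
      have h3 := mul_le_mul_of_nonneg_right h2 (mul_nonneg (by linarith : 0 ≤ K) hd0)
      linarith
    rw [Real.norm_eq_abs, e1]
    refine (abs_add_le _ _).trans ?_
    have b4 : |c * (Real.exp t * (oscKernel δ A s - δ / (δ ^ 2 + s ^ 2)) +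
        (Real.exp t - 1) * (δ / (δ ^ 2 + s ^ 2)))| ≤ D * (10 * (K * d)) := by
      rw [abs_mul]
      exact mul_le_mul hc ((abs_add_le _ _).trans (by linarith)) (abs_nonneg _) hD.le
    have b5 : 0 ≤ D * K := mul_nonneg hD.le (by linarith)
    linarith
  rw [hEint, ← Real.norm_eq_abs]
  refine (intervalIntegral.norm_integral_le_of_norm_le_const hpt).trans ?_
  rw [sub_zero, abs_of_nonneg hq]
  have : 0 ≤ (9 + 10 * D * K) * (1 + d) := by positivity
  nlinarith [mul_le_mul_of_nonneg_left hqW this]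

/-! ### The normalized Green function G near a pole -/

lemma arccotAbs_neg {δ q : ℝ} (h : δ ≠ 0 ∨ q ≠ 0) :
    arccotAbs (-δ) q = Real.pi - arccotAbs δ q := by
  have hpi := Real.pi_pos.ne'
  have h1 := arctan_sub_sign_eq_arccotAbs h
  have h2 := arctan_sub_sign_eq_arccotAbs (δ := -δ) (q := q) (by simpa using h)
  rw [div_neg, Real.arctan_neg, Real.sign_neg] at h2
  field_simp at h1 h2
  linarith

lemma arccotAbs_mul {ρ : ℝ} (hρ : 0 < ρ) (p q : ℝ) :
    arccotAbs (ρ * p) (ρ * q) = arccotAbs p q := by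
  unfold arccotAbs
  rw [← Complex.arg_real_mul ((p : ℂ) + |q| * Complex.I) hρ, abs_mul, abs_of_pos hρ]
  congr 1
  push_cast
  ring

lemma abs_arccotAbs_div_pi_le (p q : ℝ) : |arccotAbs p q / Real.pi| ≤ 1 := by
  rw [abs_div, abs_of_pos Real.pi_pos, div_le_one Real.pi_pos]
  exact Complex.abs_arg_le_pi _

/-- The Green function `G` in terms of residues and of coordinate differences. -/
def reducedGreen (k k' c c' X y : ℝ) (l : ℂ) : ℂ :=
  Complex.exp (-(l * X + l ^ 2 * y)) * (realGreen k k' c c' X y l.re |l.im| : ℝ)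

/-- Passing from 𝒢 to G cancels exactly the exponential growth left in `abs_realGreen_le`. -/
lemma norm_exp_neg_phase (X y : ℝ) (l : ℂ) :
    ‖Complex.exp (-(l * X + l ^ 2 * y))‖ * (expPhase l.re X y * Real.exp (-(|l.im| ^ 2 * y))) =
      1 := by
  unfold expPhase
  rw [Complex.norm_exp, ← Real.exp_add, ← Real.exp_add, Real.exp_eq_one_iff, sq_abs]
  simp only [Complex.neg_re, Complex.add_re, Complex.mul_re, Complex.ofReal_re,
    Complex.ofReal_im, pow_two]
  ring

lemma exp_neg_phase_mul_expPhase (k X y : ℝ) (l : ℂ) :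
    Complex.exp (-(l * X + l ^ 2 * y)) * (expPhase k X y : ℝ) =
      Complex.exp (-((l - k) * ((X + 2 * k * y : ℝ) : ℂ) + (l - k) ^ 2 * y)) := by
  unfold expPhase
  push_cast
  rw [← Complex.exp_add]
  congr 1
  ring

lemma sign_eq_sign_of_near {k k' r : ℝ} (h : |r - k| < |k - k'| / 2) :
    Real.sign (r - k') = Real.sign (k - k') := by
  have h1 := abs_lt.1 h
  rcases lt_trichotomy (k - k') 0 with h0 | h0 | h0
  · rw [abs_of_neg h0] at h1
    rw [Real.sign_of_neg h0, Real.sign_of_neg (by linarith [h1.2])]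
  · rw [h0] at h
    simp at h
    linarith [abs_nonneg (r - k)]
  · rw [abs_of_pos h0] at h1
    rw [Real.sign_of_pos h0, Real.sign_of_pos (by linarith [h1.1])]

/-- The behaviour of the Green function near `k`: a constant, an angular part, and a remainder
that vanishes at `k`. -/
lemma exists_reducedGreen_bound {k k' : ℝ} (hk : k ≠ k') :
    ∃ C : ℝ, 0 ≤ C ∧ ∀ c c' X y : ℝ, |c| ≤ |k - k'| → |c'| ≤ |k - k'| → y ≠ 0 →
      c * expPhase k X y + c' * expPhase k' X y = 0 →
      |localConst k k' c c' X y| + |c| ≤ C * timeWeight y ∧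
      ∀ l : ℂ, 0 < ‖l - k‖ → ‖l - k‖ < |k - k'| / 2 →
        ‖reducedGreen k k' c c' X y l - ((localConst k k' c c' X y +
          c * (arccotAbs (l.re - k) l.im / Real.pi) : ℝ) : ℂ)‖ ≤ C * timeWeight y ∧
        ‖reducedGreen k k' c c' X y l - ((localConst k k' c c' X y +
          c * (arccotAbs (l.re - k) l.im / Real.pi) : ℝ) : ℂ)‖ ≤
            C * timeWeight y * (1 + (|X| + |y|)) * ‖l - k‖ := by
  obtain ⟨D, hDdef⟩ : ∃ D, D = |k - k'| := ⟨_, rfl⟩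
  obtain ⟨K, hK⟩ : ∃ K, K = 1 + 2 * |k| + 2 * D := ⟨_, rfl⟩
  have hD : 0 < D := hDdef ▸ abs_pos.2 (sub_ne_zero.2 hk)
  have hK1 : 1 ≤ K := by linarith [abs_nonneg k]
  -- C₃ collects 2K(1 + 3D) from the prefactor and 3(9 + 10DK) from the segment remainder. C₄ is the
  -- bound 19D + 3 for G plus 1 + 3D for the subtracted terms.
  obtain ⟨C₃, hC₃⟩ : ∃ C₃, C₃ = 2 * K * (1 + 3 * D) + 27 + 30 * D * K := ⟨_, rfl⟩
  obtain ⟨C₄, hC₄⟩ : ∃ C₄, C₄ = 22 * D + 4 := ⟨_, rfl⟩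
  have hC₃0 : 0 ≤ C₃ := by rw [hC₃]; positivity
  have hC₄0 : 0 ≤ C₄ := by rw [hC₄]; positivity
  have hKC : 0 ≤ C₄ * K := mul_nonneg hC₄0 (by linarith)
  refine ⟨C₃ + C₄ * (1 + 2 * K), by linarith, fun c c' X y hc hc' hy hcc => ?_⟩
  rw [← hDdef] at hc hc' ⊢
  have hw := one_le_timeWeight y
  set w := timeWeight y with hwdef
  have hm := abs_localConst_le (k' := k') (c' := c') hc hcc
  set m := localConst k k' c c' X y with hmdef
  have hmc : |m| + |c| ≤ (1 + 3 * D) * w := by nlinarith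
  refine ⟨hmc.trans (mul_le_mul_of_nonneg_right (by linarith) (by linarith)),
    fun l hl0 hlD => ?_⟩
  set W := ‖l - k‖ with hW
  have hre : |l.re - k| ≤ W := by
    have := Complex.abs_re_le_norm (l - k)
    simpa using this
  have him : |l.im| ≤ W := by
    have := Complex.abs_im_le_norm (l - k)
    simpa using this
  have hr : D / 2 ≤ |l.re - k'| := by
    have := abs_sub_abs_le_abs_sub (k - k') (k - l.re)
    rw [← hDdef, abs_sub_comm k l.re] at this
    have e : k - k' - (k - l.re) = l.re - k' := by ring
    rw [e] at this
    linarith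
  have h0 : l.re - k ≠ 0 ∨ l.im ≠ 0 := by
    by_contra hcon
    push Not at hcon
    have : l - k = 0 := Complex.ext (by simpa using hcon.1) (by simpa using hcon.2)
    rw [hW, this, norm_zero] at hl0
    exact lt_irrefl _ hl0
  set arc := arccotAbs (l.re - k) l.im / Real.pi with harc
  have harc1 : |arc| ≤ 1 := abs_arccotAbs_div_pi_le _ _
  have hmarc : |m + c * arc| ≤ (1 + 3 * D) * w := by
    refine (abs_add_le _ _).trans (le_trans (add_le_add le_rfl ?_) hmc)
    rw [abs_mul]
    exact mul_le_of_le_one_right (abs_nonneg c) harc1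
  have hunif : ‖reducedGreen k k' c c' X y l - ((m + c * arc : ℝ) : ℂ)‖ ≤ C₄ * w := by
    have h1 : ‖reducedGreen k k' c c' X y l‖ ≤ (19 * D + 3) * w := by
      unfold reducedGreen
      rw [norm_mul, Complex.norm_real, Real.norm_eq_abs]
      have h2 := abs_realGreen_le hk hD hc hc' hcc hr (abs_nonneg l.im) (by linarith) hy
      refine (mul_le_mul_of_nonneg_left h2 (norm_nonneg _)).trans (le_of_eq ?_)
      rw [mul_left_comm, norm_exp_neg_phase, mul_one]
    refine (norm_sub_le _ _).trans ?_
    rw [Complex.norm_real, Real.norm_eq_abs]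
    rw [hC₄]
    linarith
  set d := |X| + |y| with hd
  have hd0 : 0 ≤ d := by positivity
  refine ⟨hunif.trans (mul_le_mul_of_nonneg_right (by linarith) (by linarith)), ?_⟩
  -- Close to k the expansion applies. Otherwise 1 < 2K · W(1 + d), so the uniform bound already has
  -- the required form.
  rcases le_or_gt (2 * K * (W * (1 + d))) 1 with hsmall | hlarge
  · have hseg := abs_segmentRemainder_le (q := |l.im|) hD hc hc' hr (abs_nonneg _) him hre
      (by linarith) hK hsmall
    set ρ := segmentRemainder k k' c c' X y l.re |l.im| with hρ
    set u : ℂ := (l - k) * ((X + 2 * k * y : ℝ) : ℂ) + (l - k) ^ 2 * y with hu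
    have hub : ‖u‖ ≤ K * (W * (1 + d)) := by
      have h1 : ‖u‖ ≤ W * (|X| + 2 * (|k| * |y|)) + W ^ 2 * |y| := by
        refine (norm_add_le _ _).trans (add_le_add ?_ ?_)
        · rw [norm_mul, Complex.norm_real, Real.norm_eq_abs]
          refine mul_le_mul_of_nonneg_left ((abs_add_le _ _).trans ?_) hl0.le
          rw [abs_mul, abs_mul, abs_two, mul_assoc]
        · rw [norm_mul, norm_pow, Complex.norm_real, Real.norm_eq_abs]
      have h2 : |X| + 2 * (|k| * |y|) + W * |y| ≤ K * (1 + d) := by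
        have a1 : W * |y| ≤ D * |y| := mul_le_mul_of_nonneg_right (by linarith) (abs_nonneg y)
        have e : K * (1 + d) = |X| + 2 * (|k| * |y|) + D * |y| +
            (K + |y| + 2 * (|k| * |X|) + 2 * (D * |X|) + D * |y|) := by rw [hK, hd]; ring
        have : 0 ≤ K + |y| + 2 * (|k| * |X|) + 2 * (D * |X|) + D * |y| := by positivity
        linarith
      have h3 := mul_le_mul_of_nonneg_left h2 hl0.le
      linarith
    have hu1 : ‖-u‖ ≤ 1 := by rw [norm_neg]; linarith
    have hexp := Complex.norm_exp_sub_one_le hu1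
    rw [norm_neg] at hexp
    have hexp3 : ‖Complex.exp (-u)‖ ≤ 3 := by
      have := norm_add_le (Complex.exp (-u) - 1) 1
      rw [sub_add_cancel, norm_one] at this
      rw [norm_neg] at hu1
      linarith
    have hG : reducedGreen k k' c c' X y l =
        Complex.exp (-u) * ((m + c * arc + ρ / Real.pi : ℝ) : ℂ) := by
      unfold reducedGreen
      rw [realGreen_eq_local hy hcc (sign_eq_sign_of_near (by rw [← hDdef]; linarith)) h0,
        Complex.ofReal_mul, ← mul_assoc, exp_neg_phase_mul_expPhase]
    have hω : reducedGreen k k' c c' X y l - ((m + c * arc : ℝ) : ℂ) =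
        (Complex.exp (-u) - 1) * ((m + c * arc : ℝ) : ℂ) +
          Complex.exp (-u) * ((ρ / Real.pi : ℝ) : ℂ) := by
      rw [hG, Complex.ofReal_add (m + c * arc)]
      ring
    rw [hω]
    have hρπ : |ρ / Real.pi| ≤ (9 + 10 * D * K) * (W * (1 + d)) := by
      rw [abs_div, abs_of_pos Real.pi_pos]
      exact (div_le_self (abs_nonneg _) (by linarith [Real.pi_gt_three])).trans hseg
    have b1 : ‖(Complex.exp (-u) - 1) * ((m + c * arc : ℝ) : ℂ)‖ ≤
        2 * (K * (W * (1 + d))) * ((1 + 3 * D) * w) := by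
      rw [norm_mul, Complex.norm_real, Real.norm_eq_abs]
      exact mul_le_mul (by linarith) hmarc (abs_nonneg _) (by positivity)
    have b2 : ‖Complex.exp (-u) * ((ρ / Real.pi : ℝ) : ℂ)‖ ≤
        3 * ((9 + 10 * D * K) * (W * (1 + d))) := by
      rw [norm_mul, Complex.norm_real, Real.norm_eq_abs]
      exact mul_le_mul hexp3 hρπ (abs_nonneg _) (by norm_num)
    have b3 : 3 * ((9 + 10 * D * K) * (W * (1 + d))) ≤
        3 * ((9 + 10 * D * K) * (W * (1 + d))) * w :=
      le_mul_of_one_le_right (by positivity) hw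
    calc _ ≤ 2 * (K * (W * (1 + d))) * ((1 + 3 * D) * w) +
          3 * ((9 + 10 * D * K) * (W * (1 + d))) * w :=
          (norm_add_le _ _).trans (by linarith)
      _ = C₃ * (w * (1 + d) * W) := by rw [hC₃]; ring
      _ ≤ (C₃ + C₄ * (1 + 2 * K)) * (w * (1 + d) * W) :=
          mul_le_mul_of_nonneg_right (by linarith) (by positivity)
      _ = _ := by ring
  · calc _ ≤ C₄ * w := hunif
      _ ≤ C₄ * w * (2 * K * (W * (1 + d))) :=
          le_mul_of_one_le_right (mul_nonneg hC₄0 (by linarith)) hlarge.le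
      _ = C₄ * (2 * K) * (w * (1 + d) * W) := by ring
      _ ≤ (C₃ + C₄ * (1 + 2 * K)) * (w * (1 + d) * W) :=
          mul_le_mul_of_nonneg_right (by linarith) (by positivity)
      _ = _ := by ring

/-- The limit of the Green function at `k` along a ray. -/
lemma tendsto_reducedGreen {k k' c c' X y : ℝ} (hk : k ≠ k') (hc : |c| ≤ |k - k'|)
    (hc' : |c'| ≤ |k - k'|) (hy : y ≠ 0)
    (hcc : c * expPhase k X y + c' * expPhase k' X y = 0) (β : ℝ) :
    Tendsto (fun r : ℝ => reducedGreen k k' c c' X y (k + r * Complex.exp (Complex.I * β)))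
      (𝓝[>] 0) (𝓝 ((localConst k k' c c' X y +
        c * (arccotAbs (Real.cos β) (Real.sin β) / Real.pi) : ℝ) : ℂ)) := by
  obtain ⟨C, -, hC⟩ := exists_reducedGreen_bound hk
  have hb := (hC c c' X y hc hc' hy hcc).2
  have hpos : 0 < |k - k'| / 2 := by
    have := abs_pos.2 (sub_ne_zero.2 hk)
    positivity
  rw [tendsto_iff_norm_sub_tendsto_zero]
  refine squeeze_zero' (g := fun r : ℝ => C * timeWeight y * (1 + (|X| + |y|)) * r)
    (Eventually.of_forall fun _ => norm_nonneg _) ?_ ?_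
  · have hlt : ∀ᶠ r : ℝ in 𝓝[>] 0, r < |k - k'| / 2 :=
      nhdsWithin_le_nhds (eventually_lt_nhds hpos)
    filter_upwards [self_mem_nhdsWithin, hlt] with r hr hrlt
    have hr0 : (0 : ℝ) < r := hr
    have hnorm : ‖(k : ℂ) + r * Complex.exp (Complex.I * β) - k‖ = r := by
      rw [add_sub_cancel_left, norm_mul, mul_comm Complex.I, Complex.norm_exp_ofReal_mul_I,
        mul_one, Complex.norm_real, Real.norm_eq_abs, abs_of_pos hr0]
    have hre : ((k : ℂ) + r * Complex.exp (Complex.I * β)).re - k = r * Real.cos β := by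
      rw [Complex.add_re, Complex.re_ofReal_mul, mul_comm Complex.I, Complex.exp_ofReal_mul_I_re,
        Complex.ofReal_re, add_sub_cancel_left]
    have him : ((k : ℂ) + r * Complex.exp (Complex.I * β)).im = r * Real.sin β := by
      rw [Complex.add_im, Complex.im_ofReal_mul, mul_comm Complex.I, Complex.exp_ofReal_mul_I_im,
        Complex.ofReal_im, zero_add]
    have := (hb _ (by rw [hnorm]; exact hr0) (by rw [hnorm]; exact hrlt)).2
    -- The angle is constant along the ray, so the remainder is the whole deviation from the limit.
    rw [hnorm, hre, him, arccotAbs_mul hr0] at this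
    exact this
  · have : Tendsto (fun r : ℝ => C * timeWeight y * (1 + (|X| + |y|)) * r) (𝓝 0)
        (𝓝 (C * timeWeight y * (1 + (|X| + |y|)) * 0)) := tendsto_id.const_mul _
    rw [mul_zero] at this
    exact this.mono_left nhdsWithin_le_nhds

/-! ### Residues of the Sato eigenfunctions and reduction of G -/

/-- The share `e^{θ₁} / τ` of the first exponential in the tau function. -/
def share₁ (κ₁ κ₂ a : ℝ) (x : ℝ × ℝ) : ℝ := Real.exp (theta κ₁ x) / tau κ₁ κ₂ a x

/-- The share `a e^{θ₂} / τ` of the second exponential in the tau function. -/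
def share₂ (κ₁ κ₂ a : ℝ) (x : ℝ × ℝ) : ℝ := a * Real.exp (theta κ₂ x) / tau κ₁ κ₂ a x

/-- The residue of `χ(x, μ) ξ(x', μ)` at `κ₁`; the one at `κ₂` is `residue₂`. -/
def residue₁ (κ₁ κ₂ a : ℝ) (x x' : ℝ × ℝ) : ℝ :=
  (κ₁ - κ₂) * (share₂ κ₁ κ₂ a x * share₁ κ₁ κ₂ a x')

def residue₂ (κ₁ κ₂ a : ℝ) (x x' : ℝ × ℝ) : ℝ :=
  (κ₂ - κ₁) * (share₁ κ₁ κ₂ a x * share₂ κ₁ κ₂ a x')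

variable {κ₁ κ₂ a : ℝ}

lemma tau_pos (ha : 0 < a) (x : ℝ × ℝ) : 0 < tau κ₁ κ₂ a x := by
  unfold tau
  positivity

lemma share_add_share (ha : 0 < a) (x : ℝ × ℝ) :
    share₁ κ₁ κ₂ a x + share₂ κ₁ κ₂ a x = 1 := by
  unfold share₁ share₂
  rw [← add_div]
  exact div_self (tau_pos ha x).ne'

lemma share₁_nonneg (ha : 0 < a) (x : ℝ × ℝ) : 0 ≤ share₁ κ₁ κ₂ a x :=
  div_nonneg (Real.exp_pos _).le (tau_pos ha x).le

lemma share₂_nonneg (ha : 0 < a) (x : ℝ × ℝ) : 0 ≤ share₂ κ₁ κ₂ a x :=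
  div_nonneg (mul_nonneg ha.le (Real.exp_pos _).le) (tau_pos ha x).le

lemma abs_residue₁_le (ha : 0 < a) (x x' : ℝ × ℝ) :
    |residue₁ κ₁ κ₂ a x x'| ≤ |κ₁ - κ₂| := by
  unfold residue₁
  rw [abs_mul]
  refine mul_le_of_le_one_right (abs_nonneg _) ?_
  have h1 := share₁_nonneg (κ₁ := κ₁) (κ₂ := κ₂) ha x
  have h2 := share₂_nonneg (κ₁ := κ₁) (κ₂ := κ₂) ha x
  have h3 := share₁_nonneg (κ₁ := κ₁) (κ₂ := κ₂) ha x'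
  have h4 := share₂_nonneg (κ₁ := κ₁) (κ₂ := κ₂) ha x'
  rw [abs_of_nonneg (mul_nonneg h2 h3)]
  exact mul_le_one₀ (by linarith [share_add_share (κ₁ := κ₁) (κ₂ := κ₂) ha x]) h3
    (by linarith [share_add_share (κ₁ := κ₁) (κ₂ := κ₂) ha x'])

lemma abs_residue₂_le (ha : 0 < a) (x x' : ℝ × ℝ) :
    |residue₂ κ₁ κ₂ a x x'| ≤ |κ₁ - κ₂| := by
  unfold residue₂
  rw [abs_mul, abs_sub_comm]
  refine mul_le_of_le_one_right (abs_nonneg _) ?_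
  have h1 := share₁_nonneg (κ₁ := κ₁) (κ₂ := κ₂) ha x
  have h2 := share₂_nonneg (κ₁ := κ₁) (κ₂ := κ₂) ha x
  have h3 := share₁_nonneg (κ₁ := κ₁) (κ₂ := κ₂) ha x'
  have h4 := share₂_nonneg (κ₁ := κ₁) (κ₂ := κ₂) ha x'
  rw [abs_of_nonneg (mul_nonneg h1 h4)]
  exact mul_le_one₀ (by linarith [share_add_share (κ₁ := κ₁) (κ₂ := κ₂) ha x]) h4
    (by linarith [share_add_share ha x' (κ₁ := κ₁) (κ₂ := κ₂)])

/-- The discrete parts at `κ₁` and `κ₂` cancel each other. -/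
lemma residue_expPhase_cancel (ha : 0 < a) (x x' : ℝ × ℝ) :
    residue₁ κ₁ κ₂ a x x' * expPhase κ₁ (x.1 - x'.1) (x.2 - x'.2) +
      residue₂ κ₁ κ₂ a x x' * expPhase κ₂ (x.1 - x'.1) (x.2 - x'.2) = 0 := by
  have h1 := (tau_pos (κ₁ := κ₁) (κ₂ := κ₂) ha x).ne'
  have h2 := (tau_pos (κ₁ := κ₁) (κ₂ := κ₂) ha x').ne'
  have e : ∀ k, expPhase k (x.1 - x'.1) (x.2 - x'.2) =
      Real.exp (theta k x) / Real.exp (theta k x') := by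
    intro k
    unfold expPhase theta
    rw [← Real.exp_sub]
    congr 1
    ring
  unfold residue₁ residue₂ share₁ share₂
  rw [e, e]
  field_simp
  ring

lemma chi_eq (x : ℝ × ℝ) {μ : ℂ} (hμ : μ ≠ 0) :
    chi κ₁ κ₂ a x μ =
      ((μ - κ₁) * share₁ κ₁ κ₂ a x + (μ - κ₂) * share₂ κ₁ κ₂ a x) / μ := by
  unfold chi share₁ share₂
  push_cast
  field_simp

lemma xi_eq (x : ℝ × ℝ) {μ : ℂ} (hμ : μ ≠ 0) :
    xi κ₁ κ₂ a x μ =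
      μ * (share₁ κ₁ κ₂ a x / (μ - κ₁) + share₂ κ₁ κ₂ a x / (μ - κ₂)) := by
  have h : ∀ k : ℝ, 1 - (k : ℂ) / μ = (μ - k) / μ := fun k => by field_simp
  unfold xi share₁ share₂
  rw [h, h]
  push_cast
  simp only [div_div_eq_mul_div]
  ring

/-- The factor μ of ξ cancels the 1/μ of χ; since the shares sum to 1, the partial fractions have
constant term 1. -/
lemma chi_mul_xi (ha : 0 < a) (x x' : ℝ × ℝ) {μ : ℂ} (hμ : μ ≠ 0) (h₁ : μ ≠ κ₁) (h₂ : μ ≠ κ₂) :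
    chi κ₁ κ₂ a x μ * xi κ₁ κ₂ a x' μ =
      twoPole κ₁ κ₂ (residue₁ κ₁ κ₂ a x x') (residue₂ κ₁ κ₂ a x x') μ := by
  have e : ∀ x, (share₂ κ₁ κ₂ a x : ℂ) = 1 - share₁ κ₁ κ₂ a x := by
    intro x
    rw [← Complex.ofReal_one, ← share_add_share (κ₁ := κ₁) (κ₂ := κ₂) ha x]
    push_cast
    ring
  rw [chi_eq x hμ, xi_eq x' hμ]
  unfold twoPole residue₁ residue₂
  push_cast
  rw [e, e]
  have h₁' := sub_ne_zero.2 h₁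
  have h₂' := sub_ne_zero.2 h₂
  field_simp
  ring

lemma phase_sub (μ : ℂ) (x x' : ℝ × ℝ) : phase μ x + -phase μ x' =
    μ * ((x.1 - x'.1 : ℝ) : ℂ) + μ ^ 2 * ((x.2 - x'.2 : ℝ) : ℂ) := by
  unfold phase
  push_cast
  ring

lemma phi_mul_psi (ha : 0 < a) (x x' : ℝ × ℝ) (r : ℝ) {s : ℝ} (hs : s ≠ 0) :
    phi κ₁ κ₂ a x (r + Complex.I * s) * psi κ₁ κ₂ a x' (r + Complex.I * s) =
      lineIntegrand κ₁ κ₂ (residue₁ κ₁ κ₂ a x x') (residue₂ κ₁ κ₂ a x x')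
        (x.1 - x'.1) (x.2 - x'.2) r s := by
  have hne : ∀ k : ℝ, (r : ℂ) + Complex.I * s ≠ k := by
    intro k h
    have := congrArg Complex.im h
    simp at this
    exact hs this
  unfold phi psi lineIntegrand
  rw [← chi_mul_xi ha x x' (by simpa using hne 0) (hne κ₁) (hne κ₂), ← phase_sub, Complex.exp_add]
  ring

/-- The product (μ - k) f(μ) agrees off k with a function continuous at k, so the limit defining the
residue is the value of that function. -/
lemma simpleResidue_eq {k k' : ℝ} (hk : k ≠ k') (x : ℝ × ℝ) (A B : ℂ) {f : ℂ → ℂ}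
    (hf : ∀ᶠ μ in 𝓝[≠] (k : ℂ),
      f μ = Complex.exp (-phase μ x) * (μ * (A / (μ - k) + B / (μ - k')))) :
    simpleResidue f k = Complex.exp (-phase k x) * (k * A) := by
  have hkk : (k : ℂ) - k' ≠ 0 := by
    rw [← Complex.ofReal_sub]
    exact Complex.ofReal_ne_zero.2 (sub_ne_zero.2 hk)
  have hcont : ContinuousAt (fun μ : ℂ => Complex.exp (-phase μ x) *
      (μ * (A + B * (μ - k) / (μ - k')))) k := by
    unfold phase
    refine ContinuousAt.mul (by fun_prop) (ContinuousAt.mul (by fun_prop)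
      (ContinuousAt.add (by fun_prop) (ContinuousAt.div (by fun_prop) (by fun_prop) hkk)))
  have hlim : Tendsto (fun μ => (μ - k) * f μ) (𝓝[≠] (k : ℂ))
      (𝓝 (Complex.exp (-phase k x) * (k * A))) := by
    have h1 := hcont.tendsto.mono_left (nhdsWithin_le_nhds (s := {(k : ℂ)}ᶜ))
    simp only [sub_self, mul_zero, zero_div, add_zero] at h1
    refine h1.congr' ?_
    filter_upwards [hf, self_mem_nhdsWithin] with μ hμ hne
    have hne' : μ - k ≠ 0 := sub_ne_zero.2 hne
    rw [hμ]
    field_simp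
  exact hlim.limUnder_eq

lemma eventually_psi_eq {k : ℝ} (hk : k ≠ 0) (x : ℝ × ℝ) :
    ∀ᶠ μ in 𝓝[≠] (k : ℂ), psi κ₁ κ₂ a x μ = Complex.exp (-phase μ x) *
      (μ * (share₁ κ₁ κ₂ a x / (μ - κ₁) + share₂ κ₁ κ₂ a x / (μ - κ₂))) := by
  have : ∀ᶠ μ : ℂ in 𝓝[≠] (k : ℂ), μ ≠ 0 :=
    nhdsWithin_le_nhds (isOpen_ne.mem_nhds (Complex.ofReal_ne_zero.2 hk))
  filter_upwards [this] with μ hμ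
  rw [psi, xi_eq x hμ]

lemma psiAt_κ₁ (hκ : κ₁ ≠ κ₂) (hκ₁ : κ₁ ≠ 0) (x : ℝ × ℝ) :
    psiAt κ₁ κ₂ a κ₁ x = Complex.exp (-phase κ₁ x) * (κ₁ * share₁ κ₁ κ₂ a x) :=
  simpleResidue_eq hκ x _ _ (eventually_psi_eq hκ₁ x)

lemma psiAt_κ₂ (hκ : κ₁ ≠ κ₂) (hκ₂ : κ₂ ≠ 0) (x : ℝ × ℝ) :
    psiAt κ₁ κ₂ a κ₂ x = Complex.exp (-phase κ₂ x) * (κ₂ * share₂ κ₁ κ₂ a x) := by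
  refine simpleResidue_eq hκ.symm x _ (share₁ κ₁ κ₂ a x) ?_
  filter_upwards [eventually_psi_eq hκ₂ x] with μ hμ
  rw [hμ, add_comm (_ / _)]

/-- At μ = κ₁ only the second share survives in χ, and only the first has a pole in ξ; the factors
1/κ₁ and κ₁ cancel. -/
lemma chiAt_mul_xiAt_κ₁ (hκ : κ₁ ≠ κ₂) (hκ₁ : κ₁ ≠ 0) (x x' : ℝ × ℝ) :
    chiAt κ₁ κ₂ a κ₁ x * xiAt κ₁ κ₂ a κ₁ x' = residue₁ κ₁ κ₂ a x x' := by
  have h0 : (κ₁ : ℂ) ≠ 0 := Complex.ofReal_ne_zero.2 hκ₁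
  unfold chiAt xiAt phiAt phi residue₁
  rw [psiAt_κ₁ hκ hκ₁, chi_eq x h0, ← mul_assoc (Complex.exp _), ← Complex.exp_add,
    ← mul_assoc (Complex.exp _), ← Complex.exp_add, neg_add_cancel, add_neg_cancel,
    Complex.exp_zero]
  push_cast
  field_simp
  ring

lemma chiAt_mul_xiAt_κ₂ (hκ : κ₁ ≠ κ₂) (hκ₂ : κ₂ ≠ 0) (x x' : ℝ × ℝ) :
    chiAt κ₁ κ₂ a κ₂ x * xiAt κ₁ κ₂ a κ₂ x' = residue₂ κ₁ κ₂ a x x' := by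
  have h0 : (κ₂ : ℂ) ≠ 0 := Complex.ofReal_ne_zero.2 hκ₂
  unfold chiAt xiAt phiAt phi residue₂
  rw [psiAt_κ₂ hκ hκ₂, chi_eq x h0, ← mul_assoc (Complex.exp _), ← Complex.exp_add,
    ← mul_assoc (Complex.exp _), ← Complex.exp_add, neg_add_cancel, add_neg_cancel,
    Complex.exp_zero]
  push_cast
  field_simp
  ring

lemma phiAt_mul_psiAt (k : ℝ) (x x' : ℝ × ℝ) :
    phiAt κ₁ κ₂ a k x * psiAt κ₁ κ₂ a k x' =
      (chiAt κ₁ κ₂ a k x * xiAt κ₁ κ₂ a k x') *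
        (expPhase k (x.1 - x'.1) (x.2 - x'.2) : ℝ) := by
  have h : ((expPhase k (x.1 - x'.1) (x.2 - x'.2) : ℝ) : ℂ) =
      Complex.exp (phase k x + -phase k x') := by
    rw [phase_sub]
    unfold expPhase
    push_cast
    rfl
  unfold chiAt xiAt
  rw [h, Complex.exp_add, Complex.exp_neg, Complex.exp_neg]
  have h1 := Complex.exp_ne_zero (phase k x)
  have h2 := Complex.exp_ne_zero (phase k x')
  field_simp

lemma calGreenD_eq (hκ : κ₁ ≠ κ₂) (hκ₁ : κ₁ ≠ 0) (hκ₂ : κ₂ ≠ 0) (x x' : ℝ × ℝ) (l : ℂ) :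
    calGreenD κ₁ κ₂ a x x' l = ((-(heaviside (-(x.2 - x'.2)) * (heaviside (l.re - κ₁) *
      (residue₁ κ₁ κ₂ a x x' * expPhase κ₁ (x.1 - x'.1) (x.2 - x'.2)) +
      heaviside (l.re - κ₂) *
        (residue₂ κ₁ κ₂ a x x' * expPhase κ₂ (x.1 - x'.1) (x.2 - x'.2)))) : ℝ) : ℂ) := by
  unfold calGreenD
  rw [mul_assoc (heaviside (l.re - κ₁) : ℂ), mul_assoc (heaviside (l.re - κ₂) : ℂ),
    phiAt_mul_psiAt, phiAt_mul_psiAt, chiAt_mul_xiAt_κ₁ hκ hκ₁, chiAt_mul_xiAt_κ₂ hκ hκ₂,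
    neg_sub]
  push_cast
  ring

/-- The principal value never evaluates the integrand at s = 0, so the rational form of χξ can be
used even if the line meets a pole. The imaginary part enters only through its square. -/
lemma calGreenC_eq (ha : 0 < a) {x x' : ℝ × ℝ} (hx : x.2 ≠ x'.2) (l : ℂ) :
    calGreenC κ₁ κ₂ a x x' l = ((-(Real.sign (x.2 - x'.2) / Real.pi) *
      expPhase l.re (x.1 - x'.1) (x.2 - x'.2) *
        cutIntegral κ₁ κ₂ (residue₁ κ₁ κ₂ a x x') (residue₂ κ₁ κ₂ a x x')
          (x.1 - x'.1) (x.2 - x'.2) l.re |l.im| : ℝ) : ℂ) := by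
  have h := tendsto_cut_lineIntegrand κ₁ κ₂ (residue₁ κ₁ κ₂ a x x') (residue₂ κ₁ κ₂ a x x')
    (x.1 - x'.1) l.re |l.im| (sub_ne_zero.2 hx)
  have hpv : pvIntegral (fun s : ℝ =>
      (heaviside ((s ^ 2 - l.im ^ 2) * (x.2 - x'.2)) : ℂ) *
        phi κ₁ κ₂ a x (l.re + Complex.I * s) * psi κ₁ κ₂ a x' (l.re + Complex.I * s)) =
      ((2 * Real.exp (l.re * (x.1 - x'.1) + l.re ^ 2 * (x.2 - x'.2)) *
        cutIntegral κ₁ κ₂ (residue₁ κ₁ κ₂ a x x') (residue₂ κ₁ κ₂ a x x')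
          (x.1 - x'.1) (x.2 - x'.2) l.re |l.im| : ℝ) : ℂ) := by
    refine Tendsto.limUnder_eq (h.congr' ?_)
    filter_upwards [self_mem_nhdsWithin] with ε hε
    refine setIntegral_congr_fun (measurableSet_lt_abs ε) fun s hs => ?_
    have hs0 : s ≠ 0 := abs_pos.1 (lt_trans hε hs)
    simp only [sq_abs]
    rw [mul_assoc, phi_mul_psi ha x x' l.re hs0]
  unfold calGreenC
  rw [hpv]
  unfold expPhase
  push_cast
  field_simp

lemma green_eq_reducedGreen (hκ : κ₁ ≠ κ₂) (hκ₁ : κ₁ ≠ 0) (hκ₂ : κ₂ ≠ 0) (ha : 0 < a)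
    {x x' : ℝ × ℝ} (hx : x.2 ≠ x'.2) (l : ℂ) :
    green κ₁ κ₂ a x x' l = reducedGreen κ₁ κ₂ (residue₁ κ₁ κ₂ a x x') (residue₂ κ₁ κ₂ a x x')
      (x.1 - x'.1) (x.2 - x'.2) l := by
  unfold green reducedGreen calGreen realGreen
  rw [calGreenC_eq ha hx, calGreenD_eq hκ hκ₁ hκ₂, ← Complex.ofReal_add, ← sub_eq_add_neg]
  simp [phase]

lemma green_eq_conj (hκ : κ₁ ≠ κ₂) (hκ₁ : κ₁ ≠ 0) (hκ₂ : κ₂ ≠ 0) (ha : 0 < a)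
    (x x' : ℝ × ℝ) (l : ℂ) :
    green κ₁ κ₂ a x x' l = starRingEnd ℂ (green κ₁ κ₂ a x x' (starRingEnd ℂ l)) := by
  have hexp : starRingEnd ℂ (Complex.exp (-phase (starRingEnd ℂ l) (x - x'))) =
      Complex.exp (-phase l (x - x')) := by
    rw [← Complex.exp_conj]
    simp [phase]
  have hreal : ∀ l, ∃ b : ℝ, calGreen κ₁ κ₂ a x x' l = b ∧
      calGreen κ₁ κ₂ a x x' (starRingEnd ℂ l) = b := by
    intro l
    unfold calGreen
    by_cases hx : x.2 = x'.2
    -- At equal times sign 0 = 0 annihilates the continuous part, so convergence of the integral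
    -- plays no role.
    · have hC : ∀ l, calGreenC κ₁ κ₂ a x x' l = 0 := by
        intro l
        simp [calGreenC, hx]
      rw [hC, hC, calGreenD_eq hκ hκ₁ hκ₂, calGreenD_eq hκ hκ₁ hκ₂, Complex.conj_re, zero_add]
      exact ⟨_, rfl, rfl⟩
    · rw [calGreenC_eq ha hx, calGreenC_eq ha hx, calGreenD_eq hκ hκ₁ hκ₂,
        calGreenD_eq hκ hκ₁ hκ₂, Complex.conj_re, Complex.conj_im, abs_neg, ← Complex.ofReal_add]
      exact ⟨_, rfl, rfl⟩
  obtain ⟨b, h1, h2⟩ := hreal l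
  unfold green
  rw [h1, h2, map_mul, hexp, Complex.conj_ofReal]

/-- The poles play symmetric roles, so one local analysis serves for both. -/
lemma reducedGreen_swap (k k' c c' X y : ℝ) (l : ℂ) :
    reducedGreen k k' c c' X y l = reducedGreen k' k c' c X y l := by
  unfold reducedGreen
  rw [realGreen_swap]

/-- The constants at `κ₁` and `κ₂` differ by the ratio of the two exponentials. -/
lemma localConst_mul_expPhase {k₁ k₂ c₁ c₂ X y : ℝ} (hk : k₁ < k₂)
    (hc : c₁ * expPhase k₁ X y + c₂ * expPhase k₂ X y = 0) :
    (localConst k₂ k₁ c₂ c₁ X y + c₂) * expPhase k₂ X y =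
      expPhase k₁ X y * localConst k₁ k₂ c₁ c₂ X y := by
  unfold localConst
  -- The sign term is 0 at k₂ and -c₁ at k₁, so the claim amounts to the cancellation of the
  -- residues.
  rw [Real.sign_of_pos (sub_pos.2 hk), Real.sign_of_neg (sub_neg.2 hk),
    background_swap k₂ k₁]
  have h1 := (expPhase_pos k₁ X y).ne'
  have h2 := (expPhase_pos k₂ X y).ne'
  field_simp
  linear_combination 2 * hc

lemma lt_half_of_mem_puncturedDisc {k : ℝ} {l : ℂ} (h : l ∈ puncturedDisc κ₁ κ₂ k) (hκ : κ₁ < κ₂) :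
    ‖l - k‖ < |κ₁ - κ₂| / 2 := by
  refine h.2.trans_le ?_
  unfold radius
  rw [abs_sub_comm, abs_of_pos (sub_pos.2 hκ)]
  exact div_le_div_of_nonneg_right (min_le_right _ _) zero_le_two

end KPGreen
end

theorem mainTheorem6 (κ₁ κ₂ a : ℝ) (hκ : κ₁ < κ₂) (hκ₁ : κ₁ ≠ 0) (hκ₂ : κ₂ ≠ 0) (ha : 0 < a) :
    (∀ (x x' : ℝ × ℝ) (l : ℂ),
      green κ₁ κ₂ a x x' l = starRingEnd ℂ (green κ₁ κ₂ a x x' (starRingEnd ℂ l))) ∧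
    ∃ (g₁ g₂ : ℝ × ℝ → ℝ × ℝ → ℂ) (ω₁ ω₂ : ℝ × ℝ → ℝ × ℝ → ℂ → ℂ) (C : ℝ),
      ∀ x x' : ℝ × ℝ, x.2 ≠ x'.2 →
        (∀ l ∈ puncturedDisc κ₁ κ₂ κ₁,
          green κ₁ κ₂ a x x' l =
            g₁ x x' + (1 / Real.pi : ℝ) * chiAt κ₁ κ₂ a κ₁ x * xiAt κ₁ κ₂ a κ₁ x' *
              (arccotAbs (l.re - κ₁) l.im : ℝ) + ω₁ x x' l) ∧
        (∀ l ∈ puncturedDisc κ₁ κ₂ κ₂,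
          green κ₁ κ₂ a x x' l =
            g₂ x x' - (1 / Real.pi : ℝ) * chiAt κ₁ κ₂ a κ₂ x * xiAt κ₁ κ₂ a κ₂ x' *
              (arccotAbs (κ₂ - l.re) l.im : ℝ) + ω₂ x x' l) ∧
        ‖g₁ x x'‖ ≤ C * weight x x' ∧
        ‖g₂ x x'‖ ≤ C * weight x x' ∧
        (∀ l ∈ puncturedDisc κ₁ κ₂ κ₁,
          ‖ω₁ x x' l‖ ≤ C * weight x x' ∧
          ‖ω₁ x x' l / (l - κ₁)‖ ≤ C * weight x x' * (1 + dist₁ x x')) ∧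
        (∀ l ∈ puncturedDisc κ₁ κ₂ κ₂,
          ‖ω₂ x x' l‖ ≤ C * weight x x' ∧
          ‖ω₂ x x' l / (l - κ₂)‖ ≤ C * weight x x' * (1 + dist₁ x x')) ∧
        g₂ x x' * Complex.exp (κ₂ * (x.1 - x'.1) + κ₂ ^ 2 * (x.2 - x'.2)) =
          Complex.exp (κ₁ * (x.1 - x'.1) + κ₁ ^ 2 * (x.2 - x'.2)) * g₁ x x' ∧
        ∀ α : ℝ, ∃ L₁ L₂ : ℂ,
          Tendsto (fun r : ℝ =>
            green κ₁ κ₂ a x x' (κ₁ + r * Complex.exp (Complex.I * (Real.pi + α))))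
            (𝓝[>] 0) (𝓝 L₁) ∧
          Tendsto (fun r : ℝ =>
            green κ₁ κ₂ a x x' (κ₂ + r * Complex.exp (Complex.I * α))) (𝓝[>] 0) (𝓝 L₂) ∧
          L₂ * Complex.exp (κ₂ * (x.1 - x'.1) + κ₂ ^ 2 * (x.2 - x'.2)) =
            Complex.exp (κ₁ * (x.1 - x'.1) + κ₁ ^ 2 * (x.2 - x'.2)) * L₁ := by
  refine ⟨green_eq_conj hκ.ne hκ₁ hκ₂ ha, ?_⟩
  obtain ⟨C₁, hC₁0, hC₁⟩ := exists_reducedGreen_bound hκ.ne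
  obtain ⟨C₂, hC₂0, hC₂⟩ := exists_reducedGreen_bound hκ.ne'
  refine ⟨fun x x' => (localConst κ₁ κ₂ (residue₁ κ₁ κ₂ a x x') (residue₂ κ₁ κ₂ a x x')
      (x.1 - x'.1) (x.2 - x'.2) : ℝ),
    -- The added residue comes from cot⁻¹(t) = π - cot⁻¹(-t), needed because the angle at κ₂ is
    -- measured from κ₂ - λ_R.
    fun x x' => (localConst κ₂ κ₁ (residue₂ κ₁ κ₂ a x x') (residue₁ κ₁ κ₂ a x x')
      (x.1 - x'.1) (x.2 - x'.2) + residue₂ κ₁ κ₂ a x x' : ℝ),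
    fun x x' l => green κ₁ κ₂ a x x' l -
      (localConst κ₁ κ₂ (residue₁ κ₁ κ₂ a x x') (residue₂ κ₁ κ₂ a x x')
        (x.1 - x'.1) (x.2 - x'.2) +
      residue₁ κ₁ κ₂ a x x' * (arccotAbs (l.re - κ₁) l.im / Real.pi) : ℝ),
    fun x x' l => green κ₁ κ₂ a x x' l -
      (localConst κ₂ κ₁ (residue₂ κ₁ κ₂ a x x') (residue₁ κ₁ κ₂ a x x')
        (x.1 - x'.1) (x.2 - x'.2) +
      residue₂ κ₁ κ₂ a x x' * (arccotAbs (l.re - κ₂) l.im / Real.pi) : ℝ),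
    C₁ + C₂, fun x x' hx => ?_⟩
  have hpi : (Real.pi : ℂ) ≠ 0 := Complex.ofReal_ne_zero.2 Real.pi_ne_zero
  have hcc := residue_expPhase_cancel (κ₁ := κ₁) (κ₂ := κ₂) ha x x'
  have hcc' := hcc
  rw [add_comm] at hcc'
  have hb₁ := abs_residue₁_le (κ₁ := κ₁) (κ₂ := κ₂) ha x x'
  have hb₂ := abs_residue₂_le (κ₁ := κ₁) (κ₂ := κ₂) ha x x'
  have hb₁' := hb₁
  have hb₂' := hb₂
  rw [abs_sub_comm κ₁ κ₂] at hb₁' hb₂'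
  have hy := sub_ne_zero.2 hx
  have hgreen := green_eq_reducedGreen hκ.ne hκ₁ hκ₂ ha hx
  have hchi₁ := chiAt_mul_xiAt_κ₁ (a := a) hκ.ne hκ₁ x x'
  have hchi₂ := chiAt_mul_xiAt_κ₂ (a := a) hκ.ne hκ₂ x x'
  have hwdef : weight x x' = timeWeight (x.2 - x'.2) := rfl
  have hddef : dist₁ x x' = |x.1 - x'.1| + |x.2 - x'.2| := by
    rw [dist₁, abs_sub_comm x'.1, abs_sub_comm x'.2]
  set c₁ := residue₁ κ₁ κ₂ a x x'
  set c₂ := residue₂ κ₁ κ₂ a x x'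
  set X := x.1 - x'.1 with hX
  set y := x.2 - x'.2 with hydef
  obtain ⟨hm₁, hω₁⟩ := hC₁ c₁ c₂ X y hb₁ hb₂ hy hcc
  obtain ⟨hm₂, hω₂⟩ := hC₂ c₂ c₁ X y hb₂' hb₁' hy hcc'
  have hw := one_le_timeWeight y
  have hwt : 0 ≤ timeWeight y := by linarith
  have hC₁le : C₁ * timeWeight y ≤ (C₁ + C₂) * timeWeight y :=
    mul_le_mul_of_nonneg_right (by linarith) hwt
  have hC₂le : C₂ * timeWeight y ≤ (C₁ + C₂) * timeWeight y :=
    mul_le_mul_of_nonneg_right (by linarith) hwt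
  have hd0 : 0 ≤ 1 + (|X| + |y|) := by positivity
  have hE : ∀ k : ℝ, Complex.exp (k * (x.1 - x'.1) + k ^ 2 * (x.2 - x'.2)) =
      (expPhase k X y : ℝ) := by
    intro k
    unfold expPhase
    rw [hX, hydef]
    push_cast
    rfl
  have hconst := localConst_mul_expPhase hκ hcc
  rw [hwdef, hddef, hE, hE]
  refine ⟨fun l hl => ?_, fun l hl => ?_, ?_, ?_, fun l hl => ?_, fun l hl => ?_, ?_, fun α => ?_⟩
  · rw [mul_assoc ((1 / Real.pi : ℝ) : ℂ), hchi₁]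
    push_cast
    field_simp
    ring
  · have h0 : l.re - κ₂ ≠ 0 ∨ l.im ≠ 0 := by
      by_contra hcon
      push Not at hcon
      have : l - κ₂ = 0 := Complex.ext (by simpa using hcon.1) (by simpa using hcon.2)
      have h := hl.1
      rw [this, norm_zero] at h
      exact lt_irrefl _ h
    rw [mul_assoc ((1 / Real.pi : ℝ) : ℂ), hchi₂, ← neg_sub l.re κ₂, arccotAbs_neg h0]
    push_cast
    field_simp
    ring
  · rw [Complex.norm_real, Real.norm_eq_abs]
    linarith [abs_nonneg c₁]
  · rw [Complex.norm_real, Real.norm_eq_abs]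
    exact (abs_add_le _ _).trans (hm₂.trans hC₂le)
  · obtain ⟨h1, h2⟩ := hω₁ l hl.1 (lt_half_of_mem_puncturedDisc hl hκ)
    rw [← hgreen] at h1 h2
    refine ⟨h1.trans hC₁le, ?_⟩
    rw [norm_div, div_le_iff₀ hl.1]
    exact h2.trans (mul_le_mul_of_nonneg_right (mul_le_mul_of_nonneg_right hC₁le hd0)
      (norm_nonneg _))
  · have hlt := lt_half_of_mem_puncturedDisc hl hκ
    rw [abs_sub_comm] at hlt
    obtain ⟨h1, h2⟩ := hω₂ l hl.1 hlt
    rw [reducedGreen_swap, ← hgreen] at h1 h2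
    refine ⟨h1.trans hC₂le, ?_⟩
    rw [norm_div, div_le_iff₀ hl.1]
    exact h2.trans (mul_le_mul_of_nonneg_right (mul_le_mul_of_nonneg_right hC₂le hd0)
      (norm_nonneg _))
  · rw [← Complex.ofReal_mul, ← Complex.ofReal_mul, hconst]
  · have t₁ := tendsto_reducedGreen hκ.ne hb₁ hb₂ hy hcc (Real.pi + α)
    have t₂ := tendsto_reducedGreen hκ.ne' hb₂' hb₁' hy hcc' α
    simp only [reducedGreen_swap κ₂ κ₁, ← hgreen] at t₂
    simp only [← hgreen, Complex.ofReal_add] at t₁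
    refine ⟨_, _, t₁, t₂, ?_⟩
    -- Opposite rays have supplementary angles, since the imaginary part enters only through its
    -- absolute value.
    have hneg : arccotAbs (Real.cos α) (Real.sin α) =
        Real.pi - arccotAbs (Real.cos (Real.pi + α)) (Real.sin (Real.pi + α)) := by
      have h0 : Real.cos (Real.pi + α) ≠ 0 ∨ Real.sin (Real.pi + α) ≠ 0 := by
        by_contra hcon
        push Not at hcon
        have := Real.sin_sq_add_cos_sq (Real.pi + α)
        rw [hcon.1, hcon.2] at this
        norm_num at this
      rw [← arccotAbs_neg h0]
      unfold arccotAbs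
      rw [add_comm Real.pi α, Real.cos_add_pi, Real.sin_add_pi, neg_neg, abs_neg]
    rw [hneg]
    have hconst' := congrArg (fun b : ℝ => (b : ℂ)) hconst
    have hccC := congrArg (fun b : ℝ => (b : ℂ)) hcc
    push_cast at hconst' hccC ⊢
    field_simp
    -- The constants match by `hconst'`; the angular terms match by the cancellation of the
    -- residues.
    linear_combination Real.pi * hconst' -
      (arccotAbs (Real.cos (Real.pi + α)) (Real.sin (Real.pi + α)) : ℂ) * hccC
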